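/- Let $\ell$ be a prime, $m\ge 1$ an integer and $q=\ell^m$. Then there exist an unramified extension $F$ of $\mathbb{Q}_\ell$ of degree $m$, a quaternion division algebra $D$ over $F$ (a division ring with center $F$ and $\dim_F D=4$), and a valuation $v$ on $D$ with value group $\mathbb{Z}$ whose restriction to $\mathbb{Q}_\ell$ is equivalent to the $\ell$-adic valuation, and with respect to whose restriction $F$ is a local field, such that, with $M_D=\{a\in D^* : v(a)>0\}\cup\{0\}$, $$D^*/F^*(1+M_D)\;\cong\;\mathcal{D}_{q+1},$$ where $\mathcal{D}_n$ denotes the dihedral group of order $2n$. Moreover, for each odd prime $p$ dividing $q+1$ there is a maximal subgroup $H$ of $D^*$ of index $p$ such that $F^*(1+M_D)\subseteq H$ and $H$ is not normal in $D^*$. In addition, for every integer $n>2$ the group $\mathcal{D}_n$ has a non-normal maximal subgroup of index $p$ for each odd prime $p$ dividing $n$, and every non-normal maximal subgroup of $\mathcal{D}_n$ has index an odd prime dividing $n$. -/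

import Mathlib

open scoped WithZero

namespace ValuedDivisionAlgebra

/-- `M_D`, the set of elements of positive value (`< 1` in multiplicative notation): the maximal
ideal of the valuation ring `V_D = {a | v a ≤ 1}`. -/
def maximalIdeal {D Γ : Type*} [DivisionRing D] [LinearOrderedCommGroupWithZero Γ]
    (v : Valuation D Γ) : Set D :=
  {a | v a < 1}

/-- The subgroup `1 + M_D` of `Dˣ`. -/
def onePlusMaximalIdeal {D Γ : Type*} [DivisionRing D] [LinearOrderedCommGroupWithZero Γ]
    (v : Valuation D Γ) : Subgroup Dˣ where
  carrier := {u | (u : D) - 1 ∈ maximalIdeal v}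
  one_mem' := by simp [maximalIdeal]
  mul_mem' := by
    intro a b ha hb
    simp only [Set.mem_ofPred_eq, maximalIdeal] at ha hb ⊢
    have h1 : v (a : D) = 1 := by
      have := v.map_one_add_of_lt ha
      simpa using this
    have : ((a * b : Dˣ) : D) - 1 = a * ((b : D) - 1) + ((a : D) - 1) := by
      rw [Units.val_mul, mul_sub, mul_one]; abel
    rw [this]
    exact v.map_add_lt (by simpa [h1] using hb) ha
  inv_mem' := by
    intro a ha
    simp only [Set.mem_ofPred_eq, maximalIdeal] at ha ⊢
    have h1 : v (a : D) = 1 := by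
      have := v.map_one_add_of_lt ha
      simpa using this
    have : ((a⁻¹ : Dˣ) : D) - 1 = (a⁻¹ : Dˣ) * (1 - (a : D)) := by
      rw [mul_sub, mul_one, Units.inv_mul]
    rw [this, map_mul, Valuation.map_sub_swap]
    simpa [h1] using ha

instance onePlusMaximalIdeal_normal {D Γ : Type*} [DivisionRing D]
    [LinearOrderedCommGroupWithZero Γ] (v : Valuation D Γ) : (onePlusMaximalIdeal v).Normal where
  conj_mem := by
    intro n hn g
    change v ((n : D) - 1) < 1 at hn
    change v (((g * n * g⁻¹ : Dˣ) : D) - 1) < 1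
    have : ((g * n * g⁻¹ : Dˣ) : D) - 1 = g * ((n : D) - 1) * (g⁻¹ : Dˣ) := by
      rw [mul_sub, sub_mul, mul_one, Units.mul_inv, Units.val_mul, Units.val_mul]
    have hg : v (g : D) * v ((g⁻¹ : Dˣ) : D) = 1 := by rw [← map_mul, Units.mul_inv, map_one]
    rw [this, map_mul, map_mul, mul_right_comm, hg, one_mul]
    exact hn

/-- The subgroup `F^*` of `D^*`, for an `F`-algebra `D`. -/
def scalarUnits (F D : Type*) [Field F] [DivisionRing D] [Algebra F D] : Subgroup Dˣ :=
  (Units.map (algebraMap F D : F →* D)).range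

instance scalarUnits_normal (F D : Type*) [Field F] [DivisionRing D] [Algebra F D] :
    (scalarUnits F D).Normal where
  conj_mem := by
    rintro _ ⟨f, rfl⟩ g
    refine ⟨f, ?_⟩
    rw [eq_mul_inv_iff_mul_eq]
    ext
    simpa using Algebra.commutes (f : F) (g : D)

/-- The normal subgroup `F^*(1 + M_D)` of `D^*`. -/
def scalarOnePlus (F : Type*) {D Γ : Type*} [Field F] [DivisionRing D] [Algebra F D]
    [LinearOrderedCommGroupWithZero Γ] (v : Valuation D Γ) : Subgroup Dˣ :=
  scalarUnits F D ⊔ onePlusMaximalIdeal v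

instance scalarOnePlus_normal (F : Type*) {D Γ : Type*} [Field F] [DivisionRing D] [Algebra F D]
    [LinearOrderedCommGroupWithZero Γ] (v : Valuation D Γ) : (scalarOnePlus F v).Normal :=
  Subgroup.sup_normal _ _

theorem mem_scalarOnePlus (F : Type*) {D Γ : Type*} [Field F] [DivisionRing D] [Algebra F D]
    [LinearOrderedCommGroupWithZero Γ] (v : Valuation D Γ) (d : Dˣ) :
    d ∈ scalarOnePlus F v ↔
      ∃ f : F, f ≠ 0 ∧ ∃ a : D, v a < 1 ∧ (d : D) = algebraMap F D f * (1 + a) := by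
  rw [scalarOnePlus, Subgroup.mem_sup_of_normal_right]
  constructor
  · rintro ⟨_, ⟨f, rfl⟩, u, hu, rfl⟩
    exact ⟨f, f.ne_zero, (u : D) - 1, hu, by simp⟩
  · rintro ⟨f, hf, a, ha, hd⟩
    have hne : (1 + a : D) ≠ 0 := by
      intro h
      rw [h, mul_zero] at hd
      exact d.ne_zero hd
    refine ⟨_, ⟨Units.mk0 f hf, rfl⟩, Units.mk0 _ hne, ?_, ?_⟩
    · change v ((1 + a) - 1) < 1
      simpa using ha
    · ext
      simpa using hd.symm

/-- `F` is a finite unramified extension of `ℚ_ℓ`: it is of finite degree, and the integral closure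
of `ℤ_ℓ` in `F` is an unramified `ℤ_ℓ`-algebra. -/
def IsFiniteUnramifiedPadic (ℓ : ℕ) [Fact ℓ.Prime] (F : Type*) [Field F] [Algebra ℚ_[ℓ] F] : Prop :=
  letI : Algebra ℤ_[ℓ] F := ((algebraMap ℚ_[ℓ] F).comp (algebraMap ℤ_[ℓ] ℚ_[ℓ])).toAlgebra
  FiniteDimensional ℚ_[ℓ] F ∧ Algebra.Unramified ℤ_[ℓ] (integralClosure ℤ_[ℓ] F)

/-- `D` is a quaternion division algebra over `F`: a division ring with center `F`, of dimension
`4` over `F`. -/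
def IsQuaternionDivisionAlgebra (F D : Type*) [Field F] [DivisionRing D] [Algebra F D] : Prop :=
  Algebra.IsCentral F D ∧ Module.finrank F D = 4

/-- `F` is a nonarchimedean local field with respect to the valuation `w`: for the equivalence
class of valuations on `F` represented by `w` and the topology that `w` defines on `F`, `F` is
locally compact and `w` is nontrivial. -/
def IsLocalFieldFor {F Γ : Type*} [Field F] [LinearOrderedCommGroupWithZero Γ]
    (w : Valuation F Γ) : Prop :=
  ∃ (_ : ValuativeRel F) (_ : TopologicalSpace F), w.Compatible ∧ IsNonarchimedeanLocalField F

/-- A maximal subgroup that is not normal. -/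
def IsNonnormalMaximal {G : Type*} [Group G] (H : Subgroup G) : Prop :=
  IsCoatom H ∧ ¬ H.Normal

end ValuedDivisionAlgebra

/-! Dihedral groups. A non-normal maximal subgroup `H` of `D_n` contains a reflection, since
otherwise it would be the rotation subgroup, which has index 2. Its rotations form a proper subgroup
of `ZMod n`, so they die in `ZMod p` for some prime `p ∣ n`. Hence `H` lies in the preimage of an
order-2 subgroup of `D_p`, which has index `p`, and maximality gives equality. Conversely, for odd
`p` such preimages are maximal and not normal.

Division algebra. Let `K` be the fraction field of the Witt vectors of the field with `q ^ 2`
elements, let `F` be the fixed field of the `m`-th power of Frobenius, and put `D = K ⊕ Kπ` with `π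
^ 2 = ℓ` and `π x = x̄ π`. In the norm form `x x̄ - ℓ y ȳ` the two terms have values of opposite
parity and cannot cancel (`val_nrd`). This shows at once that `D` is a division ring and that the
value of the norm is a valuation on it.

The quotient. Let `ζ` be the Teichmüller lift of a generator of the residue field's unit group.
Modulo `F^*(1 + M_D)`, the classes of `ζ` and `π` satisfy the dihedral relations, because `ζ ^ (q +
1)` and `π ^ 2` lie in `F` and `ζ π ζ = ζ ^ (q + 1) π`. The resulting map from `D_{q+1}` is
injective by parity of values and the order of `ζ` in the residue field (`dvd_of_pow_mem`,
`unitPi_mul_notMem`). It is surjective because every unit of `K` is congruent to a power of `ζ`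
(`exists_mk_eq_pow`). Non-normal maximal subgroups are then pulled back from `D_{q+1}`. -/

namespace DihedralGroup

/-! ### Non-normal maximal subgroups of dihedral groups -/

/-- The reduction homomorphism `D_n → D_p` for `p ∣ n`. -/
def castHom {n p : ℕ} (h : p ∣ n) : DihedralGroup n →* DihedralGroup p where
  toFun
    | r i => r (ZMod.castHom h (ZMod p) i)
    | sr i => sr (ZMod.castHom h (ZMod p) i)
  map_one' := by rw [one_def]; simp only [map_zero]; rfl
  map_mul' := by rintro (i | i) (j | j) <;> simp only [r_mul_r, r_mul_sr, sr_mul_r, sr_mul_sr, map_add, map_sub]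

theorem castHom_r {n p : ℕ} (h : p ∣ n) (i : ZMod n) :
    castHom h (r i) = r (ZMod.castHom h (ZMod p) i) := rfl

theorem castHom_sr {n p : ℕ} (h : p ∣ n) (i : ZMod n) :
    castHom h (sr i) = sr (ZMod.castHom h (ZMod p) i) := rfl

theorem castHom_surjective {n p : ℕ} (h : p ∣ n) : Function.Surjective (castHom h) := by
  rintro (i | i)
  · obtain ⟨j, rfl⟩ := ZMod.castHom_surjective h i
    exact ⟨r j, rfl⟩
  · obtain ⟨j, rfl⟩ := ZMod.castHom_surjective h i
    exact ⟨sr j, rfl⟩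

theorem mem_zpowers_sr {n : ℕ} (a : ZMod n) (g : DihedralGroup n) :
    g ∈ Subgroup.zpowers (sr a) ↔ g = 1 ∨ g = sr a := by
  have h2 : sr a ^ (2 : ℤ) = 1 := (zpow_two _).trans (sr_mul_self a)
  constructor
  · rintro ⟨k, rfl⟩
    obtain ⟨j, rfl | rfl⟩ := Int.even_or_odd' k
    · left
      simp only [zpow_mul, h2, one_zpow]
    · right
      simp only [zpow_add, zpow_mul, h2, one_zpow, one_mul, zpow_one]
  · rintro (rfl | rfl)
    · exact one_mem _
    · exact Subgroup.mem_zpowers _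

theorem index_zpowers_sr {n : ℕ} [NeZero n] (a : ZMod n) :
    (Subgroup.zpowers (sr a)).index = n := by
  have h := (Subgroup.zpowers (sr a)).card_mul_index
  rw [Nat.card_zpowers, orderOf_sr, nat_card] at h
  omega

theorem index_comap_castHom {n p : ℕ} [NeZero p] (h : p ∣ n) (a : ZMod p) :
    ((Subgroup.zpowers (sr a)).comap (castHom h)).index = p := by
  rw [Subgroup.index_comap_of_surjective _ (castHom_surjective h), index_zpowers_sr]

theorem isCoatom_of_index_prime {G : Type*} [Group G] {H : Subgroup G} (h : H.index.Prime) :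
    IsCoatom H := by
  refine ⟨fun h1 => by simp [h1, Nat.not_prime_one] at h, fun K hK => ?_⟩
  have h2 := Subgroup.relIndex_mul_index hK.le
  rcases (Nat.dvd_prime h).1 ⟨_, (mul_comm _ _).trans h2 |>.symm⟩ with h3 | h3
  · exact Subgroup.index_eq_one.1 h3
  · exfalso
    rw [h3] at h2
    have : H.relIndex K = 1 := Nat.eq_of_mul_eq_mul_right h.pos (by omega)
    exact hK.not_ge (Subgroup.relIndex_eq_one.1 this)

theorem not_normal_comap_castHom {n p : ℕ} (hp : p.Prime) (ho : Odd p) (h : p ∣ n) (a : ZMod p) :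
    ¬ ((Subgroup.zpowers (sr a)).comap (castHom h)).Normal := by
  intro hN
  obtain ⟨b, hb⟩ := castHom_surjective h (sr a)
  have h1 := hN.conj_mem b (by rw [Subgroup.mem_comap, hb]; exact Subgroup.mem_zpowers _) (r 1)
  rw [Subgroup.mem_comap, mem_zpowers_sr] at h1
  simp only [map_mul, hb, castHom_r, map_one, map_neg, r_mul_sr, inv_r, sr_mul_r, one_def,
    reduceCtorEq, sr.injEq, false_or] at h1
  -- Conjugation by `r 1` shifts the index of a reflection by 2, so normality would force `2 = 0`
  -- modulo `p`.
  have h2 : ((2 : ℕ) : ZMod p) = 0 := by push_cast; linear_combination -h1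
  rw [ZMod.natCast_eq_zero_iff] at h2
  rw [(Nat.prime_dvd_prime_iff_eq hp Nat.prime_two).1 h2] at ho
  exact absurd ho (by decide)

open ValuedDivisionAlgebra in
theorem exists_isNonnormalMaximal {n p : ℕ} (hp : p.Prime) (ho : Odd p) (h : p ∣ n) :
    ∃ H : Subgroup (DihedralGroup n), IsNonnormalMaximal H ∧ H.index = p := by
  have : NeZero p := ⟨hp.ne_zero⟩
  have h1 := index_comap_castHom h (0 : ZMod p)
  exact ⟨_, ⟨isCoatom_of_index_prime (h1.symm ▸ hp), not_normal_comap_castHom hp ho h 0⟩, h1⟩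

theorem index_rotations {n : ℕ} [NeZero n] : (Subgroup.zpowers (r (1 : ZMod n))).index = 2 := by
  have h := (Subgroup.zpowers (r (1 : ZMod n))).card_mul_index
  rw [Nat.card_zpowers, orderOf_r_one, nat_card, mul_comm 2 n] at h
  exact Nat.eq_of_mul_eq_mul_left (Nat.pos_of_neZero n) h

open ValuedDivisionAlgebra in
theorem exists_sr_mem {n : ℕ} [NeZero n] {H : Subgroup (DihedralGroup n)}
    (hH : IsNonnormalMaximal H) : ∃ a, sr a ∈ H := by
  by_contra! hc
  have h1 : H ≤ Subgroup.zpowers (r (1 : ZMod n)) := by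
    rintro (i | i) hi
    · exact ⟨i.cast, by change r 1 ^ (i.cast : ℤ) = r i; rw [r_one_zpow]; simp⟩
    · exact absurd hi (hc i)
  have h2 : Subgroup.zpowers (r (1 : ZMod n)) ≠ ⊤ := by
    intro h
    have := index_rotations (n := n)
    simp [h] at this
  have h3 : H = Subgroup.zpowers (r (1 : ZMod n)) :=
    ((hH.1.le_iff_eq h2).1 h1).symm
  exact hH.2 (h3 ▸ Subgroup.normal_of_index_eq_two index_rotations)

/-- The subgroup of `ZMod n` of the indices of the rotations in `H`. -/
def rotationIndices {n : ℕ} (H : Subgroup (DihedralGroup n)) : AddSubgroup (ZMod n) where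
  carrier := {i | r i ∈ H}
  zero_mem' := H.one_mem
  add_mem' := fun {i j} hi hj => by
    have := H.mul_mem hi hj
    rwa [r_mul_r] at this
  neg_mem' := fun {i} hi => by
    have := H.inv_mem hi
    rwa [inv_r] at this

/-- Any prime factor of the index of `J` works: an element `i` of `J` is killed by the order of `J`,
so the index divides `i`. -/
theorem _root_.ZMod.exists_prime_castHom_eq_zero {n : ℕ} [NeZero n] {J : AddSubgroup (ZMod n)}
    (hJ : J ≠ ⊤) :
    ∃ p : ℕ, p.Prime ∧ ∃ h : p ∣ n, ∀ i ∈ J, ZMod.castHom h (ZMod p) i = 0 := by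
  have h1 : J.index ≠ 1 := fun h => hJ (AddSubgroup.index_eq_one.1 h)
  have h2 := J.card_mul_index
  rw [Nat.card_zmod] at h2
  obtain ⟨p, hp, hpd⟩ := Nat.exists_prime_and_dvd h1
  refine ⟨p, hp, hpd.trans ⟨_, (mul_comm _ _).trans h2 |>.symm⟩, fun i hi => ?_⟩
  have h3 : Nat.card J • (⟨i, hi⟩ : J) = 0 := card_nsmul_eq_zero'
  have h4 : Nat.card J • i = 0 := congrArg Subtype.val h3
  rw [← ZMod.natCast_zmod_val i, nsmul_eq_mul, ← Nat.cast_mul, ZMod.natCast_eq_zero_iff] at h4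
  have h5 : J.index ∣ i.val := 
    Nat.dvd_of_mul_dvd_mul_left (k := Nat.card J) Nat.card_pos (h2.symm ▸ h4)
  rw [← ZMod.natCast_zmod_val i, map_natCast, ZMod.natCast_eq_zero_iff]
  exact hpd.trans h5

open ValuedDivisionAlgebra in
theorem index_of_isNonnormalMaximal {n : ℕ} [NeZero n] {H : Subgroup (DihedralGroup n)}
    (hH : IsNonnormalMaximal H) : H.index.Prime ∧ Odd H.index ∧ H.index ∣ n := by
  obtain ⟨a, ha⟩ := exists_sr_mem hH
  have hJ : rotationIndices H ≠ ⊤ := by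
    intro h
    apply hH.1.1
    rw [eq_top_iff]
    have h1 : ∀ i, r i ∈ H := fun i => (h ▸ AddSubgroup.mem_top i : i ∈ rotationIndices H)
    rintro (i | i) -
    · exact h1 i
    · have := H.mul_mem ha (h1 (i - a))
      rwa [sr_mul_r, add_sub_cancel] at this
  obtain ⟨p, hp, hpn, hc⟩ := ZMod.exists_prime_castHom_eq_zero hJ
  have : NeZero p := ⟨hp.ne_zero⟩
  have h1 : H ≤ (Subgroup.zpowers (sr (ZMod.castHom hpn (ZMod p) a))).comap (castHom hpn) := by
    rintro (i | i) hi
    · rw [Subgroup.mem_comap, mem_zpowers_sr, castHom_r, hc i hi]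
      exact Or.inl rfl
    · rw [Subgroup.mem_comap, mem_zpowers_sr, castHom_sr]
      -- The product of two reflections of `H` is a rotation of `H`, so their indices agree modulo
      -- `p`.
      have h2 := H.mul_mem ha hi
      rw [sr_mul_sr] at h2
      have h3 := hc _ h2
      rw [map_sub, sub_eq_zero] at h3
      rw [h3]
      exact Or.inr rfl
  have h2 := index_comap_castHom hpn (ZMod.castHom hpn (ZMod p) a)
  have h3 : H.index = p := by
    rw [← h2, (hH.1.le_iff_eq _).1 h1]
    intro h
    rw [h, Subgroup.index_top] at h2
    exact hp.one_lt.ne h2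
  refine ⟨h3 ▸ hp, ?_, h3 ▸ hpn⟩
  rw [h3]
  refine hp.odd_of_ne_two fun h => hH.2 (Subgroup.normal_of_index_eq_two (h3.trans h))

end DihedralGroup

/-! ### The quaternion division algebra and its valuation -/

/-- A quadratic extension `K / F` with its nontrivial automorphism, together with a valuation on `K`
invariant under it, and an element of `F` that is a uniformizer for the valuation on `K`. -/
structure UnramifiedQuadratic (F K : Type*) [Field F] [Field K] [Algebra F K] where
  /-- the nontrivial automorphism -/
  conj : K ≃ₐ[F] K
  conj_conj : ∀ x, conj (conj x) = x
  exists_conj_ne : ∃ x, conj x ≠ x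
  mem_range_of_conj : ∀ x, conj x = x → ∃ f, algebraMap F K f = x
  /-- the valuation -/
  val : Valuation K ℤᵐ⁰
  val_conj : ∀ x, val (conj x) = val x
  /-- the uniformizer -/
  param : F
  val_param : val (algebraMap F K param) = WithZero.exp (-1)

/-- The cyclic algebra `K ⊕ K π` with `π x = x̄ π` and `π ^ 2` the given uniformizer. -/
@[ext]
structure CyclicQuaternion {F K : Type*} [Field F] [Field K] [Algebra F K]
    (Q : UnramifiedQuadratic F K) where
  /-- the coefficient of `1` -/
  re : K
  /-- the coefficient of `π` -/
  im : K

namespace CyclicQuaternion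

variable {F K : Type*} [Field F] [Field K] [Algebra F K] {Q : UnramifiedQuadratic F K}

instance : Zero (CyclicQuaternion Q) := ⟨⟨0, 0⟩⟩
instance : One (CyclicQuaternion Q) := ⟨⟨1, 0⟩⟩
instance : Add (CyclicQuaternion Q) := ⟨fun x y => ⟨x.re + y.re, x.im + y.im⟩⟩
instance : Neg (CyclicQuaternion Q) := ⟨fun x => ⟨-x.re, -x.im⟩⟩
instance : Mul (CyclicQuaternion Q) :=
  ⟨fun x y => ⟨x.re * y.re + algebraMap F K Q.param * (x.im * Q.conj y.im),
    x.re * y.im + x.im * Q.conj y.re⟩⟩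
instance : SMul F (CyclicQuaternion Q) := ⟨fun a x => ⟨a • x.re, a • x.im⟩⟩

@[simp] theorem re_zero : (0 : CyclicQuaternion Q).re = 0 := rfl
@[simp] theorem im_zero : (0 : CyclicQuaternion Q).im = 0 := rfl
@[simp] theorem re_one : (1 : CyclicQuaternion Q).re = 1 := rfl
@[simp] theorem im_one : (1 : CyclicQuaternion Q).im = 0 := rfl
@[simp] theorem re_add (x y : CyclicQuaternion Q) : (x + y).re = x.re + y.re := rfl
@[simp] theorem im_add (x y : CyclicQuaternion Q) : (x + y).im = x.im + y.im := rfl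
@[simp] theorem re_neg (x : CyclicQuaternion Q) : (-x).re = -x.re := rfl
@[simp] theorem im_neg (x : CyclicQuaternion Q) : (-x).im = -x.im := rfl
@[simp] theorem re_mul (x y : CyclicQuaternion Q) :
    (x * y).re = x.re * y.re + algebraMap F K Q.param * (x.im * Q.conj y.im) := rfl
@[simp] theorem im_mul (x y : CyclicQuaternion Q) :
    (x * y).im = x.re * y.im + x.im * Q.conj y.re := rfl
@[simp] theorem re_smul (a : F) (x : CyclicQuaternion Q) : (a • x).re = a • x.re := rfl
@[simp] theorem im_smul (a : F) (x : CyclicQuaternion Q) : (a • x).im = a • x.im := rfl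

instance : AddCommGroup (CyclicQuaternion Q) where
  add_assoc x y z := by ext <;> simp [add_assoc]
  zero_add x := by ext <;> simp
  add_zero x := by ext <;> simp
  add_comm x y := by ext <;> simp [add_comm]
  neg_add_cancel x := by ext <;> simp
  nsmul := nsmulRec
  zsmul := zsmulRec

instance : Ring (CyclicQuaternion Q) where
  __ := (inferInstance : AddCommGroup (CyclicQuaternion Q))
  left_distrib x y z := by ext <;> simp <;> ring
  right_distrib x y z := by ext <;> simp <;> ring
  zero_mul x := by ext <;> simp
  mul_zero x := by ext <;> simp
  mul_assoc x y z := by ext <;> simp [Q.conj_conj] <;> ring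
  one_mul x := by ext <;> simp
  mul_one x := by ext <;> simp

instance : Module F (CyclicQuaternion Q) where
  one_smul x := by ext <;> simp
  mul_smul a b x := by ext <;> simp [mul_smul]
  smul_zero a := by ext <;> simp
  smul_add a x y := by ext <;> simp
  add_smul a b x := by ext <;> simp [add_smul]
  zero_smul x := by ext <;> simp

instance : Algebra F (CyclicQuaternion Q) :=
  Algebra.ofModule (fun a x y => by ext <;> simp [Algebra.smul_def] <;> ring)
    (fun a x y => by ext <;> simp [Algebra.smul_def] <;> ring)

@[simp] theorem re_algebraMap (a : F) :
    (algebraMap F (CyclicQuaternion Q) a).re = algebraMap F K a := by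
  simp [Algebra.algebraMap_eq_smul_one]
@[simp] theorem im_algebraMap (a : F) : (algebraMap F (CyclicQuaternion Q) a).im = 0 := by
  simp [Algebra.algebraMap_eq_smul_one]

/-- The reduced norm, with values in `K`. -/
def nrd (x : CyclicQuaternion Q) : K :=
  x.re * Q.conj x.re - algebraMap F K Q.param * (x.im * Q.conj x.im)

theorem nrd_mul (x y : CyclicQuaternion Q) : nrd (x * y) = nrd x * nrd y := by
  simp [nrd, Q.conj_conj]
  ring

/-- Parity: the logarithm of the left side is even and that of the right side is odd. -/
theorem _root_.WithZero.sq_ne_exp_neg_one_mul_sq {x y : ℤᵐ⁰} (h : x ≠ 0 ∨ y ≠ 0) :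
    x ^ 2 ≠ WithZero.exp (-1) * y ^ 2 := by
  intro he
  have hx : x ≠ 0 := by
    rintro rfl
    have : y = 0 := by simpa using he.symm
    simp [this] at h
  have hy : y ≠ 0 := by
    rintro rfl
    simp [hx] at he
  have h1 := congrArg WithZero.log he
  rw [WithZero.log_mul (by simp) (pow_ne_zero _ hy), WithZero.log_pow, WithZero.log_pow,
    WithZero.log_exp] at h1
  simp only [nsmul_eq_mul, Nat.cast_ofNat] at h1
  omega

/-- The two terms of the norm have distinct values unless both vanish, so the ultrametric inequality
is an equality. Anisotropy of the norm and the ultrametric inequality on `D` both follow from this.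
-/
theorem val_nrd (x : CyclicQuaternion Q) :
    Q.val (nrd x) = max (Q.val x.re ^ 2) (WithZero.exp (-1) * Q.val x.im ^ 2) := by
  have h1 : Q.val (x.re * Q.conj x.re) = Q.val x.re ^ 2 := by
    rw [map_mul, Q.val_conj, sq]
  have h2 : Q.val (algebraMap F K Q.param * (x.im * Q.conj x.im)) =
      WithZero.exp (-1) * Q.val x.im ^ 2 := by
    rw [map_mul, map_mul, Q.val_conj, Q.val_param, sq]
  by_cases h : Q.val x.re ≠ 0 ∨ Q.val x.im ≠ 0
  · rw [nrd, sub_eq_add_neg, Valuation.map_add_of_distinct_val, Valuation.map_neg, h1, h2]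
    rw [Valuation.map_neg, h1, h2]
    exact WithZero.sq_ne_exp_neg_one_mul_sq h
  · push Not at h
    rw [Valuation.zero_iff, Valuation.zero_iff] at h
    simp [nrd, h.1, h.2]

theorem nrd_ne_zero {x : CyclicQuaternion Q} (hx : x ≠ 0) : nrd x ≠ 0 := by
  intro h
  apply hx
  have h1 := val_nrd x
  rw [h, map_zero] at h1
  have h2 := (le_max_left _ _).trans h1.symm.le
  have h3 := (le_max_right _ _).trans h1.symm.le
  ext
  · simpa using h2
  · simpa using h3

instance : Nontrivial (CyclicQuaternion Q) :=
  ⟨0, 1, fun h => zero_ne_one (congrArg re h)⟩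

/-- The inverse is the canonical conjugate `x̄ - yπ` divided by the norm; the norm is fixed by
`conj`, hence commutes with `π`. -/
noncomputable instance : Inv (CyclicQuaternion Q) :=
  ⟨fun x => ⟨Q.conj x.re / nrd x, -x.im / nrd x⟩⟩

theorem conj_nrd (x : CyclicQuaternion Q) : Q.conj (nrd x) = nrd x := by
  simp [nrd, Q.conj_conj]
  ring

noncomputable instance : DivisionRing (CyclicQuaternion Q) where
  __ := (inferInstance : Ring (CyclicQuaternion Q))
  mul_inv_cancel x hx := by
    have h := nrd_ne_zero hx
    ext
    · change x.re * (Q.conj x.re / nrd x) +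
        algebraMap F K Q.param * (x.im * Q.conj (-x.im / nrd x)) = 1
      rw [map_div₀, conj_nrd, map_neg]
      field_simp
      rw [nrd]
      ring
    · change x.re * (-x.im / nrd x) + x.im * Q.conj (Q.conj x.re / nrd x) = 0
      rw [map_div₀, conj_nrd, Q.conj_conj]
      ring
  inv_zero := by
    ext
    · change Q.conj 0 / nrd 0 = 0
      simp
    · change -0 / nrd 0 = 0
      simp
  nnqsmul := _
  nnqsmul_def := fun _ _ => rfl
  qsmul := _
  qsmul_def := fun _ _ => rfl

/-- The valuation of `D`, normalized to have value group `ℤ`. -/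
def valuation (Q : UnramifiedQuadratic F K) : Valuation (CyclicQuaternion Q) ℤᵐ⁰ where
  toFun x := Q.val (nrd x)
  map_zero' := by simp [nrd]
  map_one' := by simp [nrd]
  map_mul' x y := by rw [nrd_mul, map_mul]
  map_add_le_max' x y := by
    -- By `val_nrd` the valuation is a maximum over coordinates, so the inequality can be checked on
    -- each coordinate.
    simp only [val_nrd, re_add, im_add]
    refine max_le ?_ ?_
    · rcases le_max_iff.1 (Q.val.map_add x.re y.re) with h | h
      · exact (pow_le_pow_left' h 2).trans ((le_max_left _ _).trans (le_max_left _ _))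
      · exact (pow_le_pow_left' h 2).trans ((le_max_left _ _).trans (le_max_right _ _))
    · rcases le_max_iff.1 (Q.val.map_add x.im y.im) with h | h
      · exact (mul_le_mul_right (pow_le_pow_left' h 2) _).trans
          ((le_max_right _ _).trans (le_max_left _ _))
      · exact (mul_le_mul_right (pow_le_pow_left' h 2) _).trans
          ((le_max_right _ _).trans (le_max_right _ _))

theorem valuation_apply (x : CyclicQuaternion Q) :
    valuation Q x = max (Q.val x.re ^ 2) (WithZero.exp (-1) * Q.val x.im ^ 2) := val_nrd x

theorem valuation_algebraMap (f : F) :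
    valuation Q (algebraMap F _ f) = Q.val (algebraMap F K f) ^ 2 := by
  simp [valuation_apply]

theorem valuation_pi : valuation Q ⟨0, 1⟩ = WithZero.exp (-1) := by
  simp [valuation_apply]

theorem valuation_surjective (Q : UnramifiedQuadratic F K) :
    Function.Surjective (valuation Q) := by
  intro y
  by_cases hy : y = 0
  · exact ⟨0, by simp [hy]⟩
  · refine ⟨⟨0, 1⟩ ^ (-WithZero.log y), ?_⟩
    rw [map_zpow₀, valuation_pi, ← WithZero.exp_zsmul]
    simp [WithZero.exp_log hy]

/-- Commuting with an element moved by `conj` kills the `π`-coordinate; commuting with `π` makes the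
other coordinate `conj`-invariant. -/
theorem isCentral (Q : UnramifiedQuadratic F K) : Algebra.IsCentral F (CyclicQuaternion Q) where
  out x hx := by
    rw [Subalgebra.mem_center_iff] at hx
    obtain ⟨c, hc⟩ := Q.exists_conj_ne
    have h1 := congrArg im (hx ⟨c, 0⟩)
    have h2 := congrArg im (hx ⟨0, 1⟩)
    simp only [im_mul, zero_mul, mul_zero, one_mul, mul_one, zero_add, add_zero] at h1 h2
    have h3 : x.im = 0 := by
      have : x.im * (Q.conj c - c) = 0 := by linear_combination -h1
      exact (mul_eq_zero.1 this).resolve_right (sub_ne_zero.2 hc)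
    obtain ⟨f, hf⟩ := Q.mem_range_of_conj _ (by simpa using h2)
    exact Algebra.mem_bot.2 ⟨f, by ext <;> simp [hf, h3]⟩

/-- `D ≃ K × K` as a vector space over `F`. -/
def linearEquivProd (Q : UnramifiedQuadratic F K) : CyclicQuaternion Q ≃ₗ[F] K × K where
  toFun x := (x.re, x.im)
  invFun x := ⟨x.1, x.2⟩
  map_add' _ _ := rfl
  map_smul' _ _ := rfl

theorem finrank_eq (Q : UnramifiedQuadratic F K) (h : Module.finrank F K = 2) :
    Module.finrank F (CyclicQuaternion Q) = 4 := by
  have : FiniteDimensional F K := .of_finrank_pos (by omega)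
  rw [(linearEquivProd Q).finrank_eq, Module.finrank_prod, h]

theorem isQuaternionDivisionAlgebra (Q : UnramifiedQuadratic F K) (h : Module.finrank F K = 2) :
    ValuedDivisionAlgebra.IsQuaternionDivisionAlgebra F (CyclicQuaternion Q) :=
  ⟨isCentral Q, finrank_eq Q h⟩

end CyclicQuaternion

/-! ### Homomorphisms out of a dihedral group -/

namespace DihedralGroup

variable {G : Type*} [Group G] {n : ℕ}

theorem _root_.zpow_zmodCast {ρ : G} (h : ρ ^ n = 1) (k : ℤ) :
    ρ ^ ((k : ZMod n).cast : ℤ) = ρ ^ k := by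
  rw [ZMod.coe_intCast]
  conv_rhs => rw [← Int.emod_add_mul_ediv k n, zpow_add, zpow_mul, zpow_natCast, h, one_zpow, mul_one]

/-- The homomorphism from `D_n` given by elements satisfying its defining relations. -/
def lift {ρ τ : G} (h1 : ρ ^ n = 1) (h2 : τ * τ = 1) (h3 : ρ * τ * ρ = τ) :
    DihedralGroup n →* G where
  toFun
    | r i => ρ ^ (i.cast : ℤ)
    | sr i => τ * ρ ^ (i.cast : ℤ)
  map_one' := by
    rw [one_def]
    simp
  map_mul' := by
    -- The relation `ρ τ ρ = τ` lets powers of `ρ` pass `τ` with inverted exponent.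
    have h4 : ∀ k : ℤ, ρ ^ k * τ = τ * ρ ^ (-k) := by
      intro k
      have h5 : SemiconjBy τ ρ⁻¹ ρ := by
        change τ * ρ⁻¹ = ρ * τ
        rw [mul_inv_eq_iff_eq_mul, h3]
      simpa using (h5.zpow_right k).eq.symm
    rintro (i | i) (j | j) <;> obtain ⟨i, rfl⟩ := ZMod.intCast_surjective i <;>
      obtain ⟨j, rfl⟩ := ZMod.intCast_surjective j
    · rw [r_mul_r, ← Int.cast_add]
      simp only [zpow_zmodCast h1, zpow_add]
    · rw [r_mul_sr, ← Int.cast_sub]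
      simp only [zpow_zmodCast h1]
      rw [← mul_assoc, h4, mul_assoc, ← zpow_add, neg_add_eq_sub]
    · rw [sr_mul_r, ← Int.cast_add]
      simp only [zpow_zmodCast h1, zpow_add, mul_assoc]
    · rw [sr_mul_sr, ← Int.cast_sub]
      simp only [zpow_zmodCast h1]
      rw [mul_assoc, ← mul_assoc _ τ, h4, mul_assoc, ← mul_assoc, h2, one_mul, ← zpow_add,
        neg_add_eq_sub]

theorem lift_r {ρ τ : G} (h1 : ρ ^ n = 1) (h2 : τ * τ = 1) (h3 : ρ * τ * ρ = τ) (k : ℕ) :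
    lift h1 h2 h3 (r (k : ZMod n)) = ρ ^ k := by
  have := zpow_zmodCast h1 k
  rwa [Int.cast_natCast, zpow_natCast] at this

theorem lift_sr {ρ τ : G} (h1 : ρ ^ n = 1) (h2 : τ * τ = 1) (h3 : ρ * τ * ρ = τ) (k : ℕ) :
    lift h1 h2 h3 (sr (k : ZMod n)) = τ * ρ ^ k := by
  rw [← lift_r h1 h2 h3]
  rfl

end DihedralGroup

/-! ### The quotient `D^* / F^*(1 + M_D)` -/

namespace CyclicQuaternion

open ValuedDivisionAlgebra

variable {F K : Type*} [Field F] [Field K] [Algebra F K] {Q : UnramifiedQuadratic F K}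

/-- `ζ` is a root of unity of order `q ^ 2 - 1` whose powers represent the nonzero residue classes
of `K`, on which the automorphism of `K` acts as the `q`-th power. -/
structure IsTeichmullerGenerator (Q : UnramifiedQuadratic F K) (q : ℕ) (ζ : K) : Prop where
  one_lt : 1 < q
  pow_eq_one : ζ ^ (q ^ 2 - 1) = 1
  conj_eq : Q.conj ζ = ζ ^ q
  exists_val_sub_lt : ∀ x, Q.val x = 1 → ∃ i : ℕ, Q.val (x - ζ ^ i) < 1
  dvd_of_val_sub_lt : ∀ i : ℕ, Q.val (ζ ^ i - 1) < 1 → q ^ 2 - 1 ∣ i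

namespace IsTeichmullerGenerator

variable {q : ℕ} {ζ : K}

theorem pow_sq (h : IsTeichmullerGenerator Q q ζ) : ζ ^ q ^ 2 = ζ := by
  have h1 : q ^ 2 = (q ^ 2 - 1) + 1 := by
    have := Nat.pow_pos (n := 2) (zero_lt_one.trans h.one_lt)
    omega
  rw [h1, pow_succ, h.pow_eq_one, one_mul]

theorem sq_sub_one_ne_zero (h : IsTeichmullerGenerator Q q ζ) : q ^ 2 - 1 ≠ 0 := by
  have := Nat.pow_lt_pow_left h.one_lt (n := 2) (by norm_num)
  omega

theorem ne_zero (h : IsTeichmullerGenerator Q q ζ) : ζ ≠ 0 := by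
  rintro rfl
  have h1 := h.pow_eq_one
  rw [zero_pow h.sq_sub_one_ne_zero] at h1
  exact zero_ne_one h1

theorem val_eq_one (h : IsTeichmullerGenerator Q q ζ) : Q.val ζ = 1 := by
  have h1 := congrArg Q.val h.pow_eq_one
  rw [map_pow, map_one] at h1
  exact (pow_eq_one_iff_of_nonneg zero_le h.sq_sub_one_ne_zero).1 h1

/-- `ζ ^ (q + 1)` is the norm `ζ ζ̄`, hence is fixed by `conj`. -/
theorem exists_algebraMap_eq (h : IsTeichmullerGenerator Q q ζ) :
    ∃ f, algebraMap F K f = ζ ^ (q + 1) := by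
  apply Q.mem_range_of_conj
  rw [map_pow, h.conj_eq, ← pow_mul, mul_add, mul_one, ← sq, pow_add, h.pow_sq, pow_succ']

end IsTeichmullerGenerator

theorem val_re_lt {x : CyclicQuaternion Q} (h : valuation Q x < 1) : Q.val x.re < 1 := by
  rw [valuation_apply] at h
  have := (le_max_left _ _).trans_lt h
  contrapose! this
  exact one_le_pow_of_one_le' this 2

/-- The unit of `D` given by a nonzero element of `K`. -/
noncomputable def unitOfNeZero (Q : UnramifiedQuadratic F K) {a : K} (ha : a ≠ 0) :
    (CyclicQuaternion Q)ˣ :=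
  Units.mk0 ⟨a, 0⟩ fun h => ha (congrArg re h)

/-- The element `π` of `D` as a unit. -/
noncomputable def unitPi (Q : UnramifiedQuadratic F K) : (CyclicQuaternion Q)ˣ :=
  Units.mk0 ⟨0, 1⟩ fun h => one_ne_zero (congrArg im h)

theorem unitOfNeZero_pow {a : K} (ha : a ≠ 0) (k : ℕ) :
    ((unitOfNeZero Q ha ^ k : (CyclicQuaternion Q)ˣ) : CyclicQuaternion Q) = ⟨a ^ k, 0⟩ := by
  induction k with
  | zero => rw [pow_zero, pow_zero]; rfl
  | succ k ih =>
    rw [pow_succ, pow_succ, Units.val_mul, ih]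
    ext <;> simp [unitOfNeZero]

theorem mk_eq_of_smul {x y : (CyclicQuaternion Q)ˣ} (f : F)
    (h : (x : CyclicQuaternion Q) = algebraMap F _ f * y) :
    (QuotientGroup.mk x : (CyclicQuaternion Q)ˣ ⧸ scalarOnePlus F (valuation Q)) =
      QuotientGroup.mk y := by
  have hf : f ≠ 0 := by
    rintro rfl
    rw [map_zero, zero_mul] at h
    exact x.ne_zero h
  refine (QuotientGroup.eq.2 ?_).symm
  rw [mem_scalarOnePlus]
  refine ⟨f, hf, 0, by simp, ?_⟩
  rw [Units.val_mul, h, Algebra.commutes, ← mul_assoc, Units.inv_mul]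
  simp

theorem pi_mul_self : (⟨0, 1⟩ * ⟨0, 1⟩ : CyclicQuaternion Q) = algebraMap F _ Q.param := by
  ext <;> simp

theorem mk_unitPi_mul_self :
    (QuotientGroup.mk (unitPi Q) : (CyclicQuaternion Q)ˣ ⧸ scalarOnePlus F (valuation Q)) *
      QuotientGroup.mk (unitPi Q) = 1 := by
  rw [← QuotientGroup.mk_mul, ← QuotientGroup.mk_one]
  refine mk_eq_of_smul Q.param ?_
  rw [Units.val_one, mul_one]
  exact pi_mul_self

variable {q : ℕ} {ζ : K}

section

variable (h : IsTeichmullerGenerator Q q ζ)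
include h

theorem mk_unitOfNeZero_pow :
    (QuotientGroup.mk (unitOfNeZero Q h.ne_zero) :
      (CyclicQuaternion Q)ˣ ⧸ scalarOnePlus F (valuation Q)) ^ (q + 1) = 1 := by
  obtain ⟨f, hf⟩ := h.exists_algebraMap_eq
  rw [← QuotientGroup.mk_pow, ← QuotientGroup.mk_one]
  refine mk_eq_of_smul f ?_
  rw [unitOfNeZero_pow]
  ext <;> simp [hf]

theorem mk_unitOfNeZero_mul_mk_unitPi :
    (QuotientGroup.mk (unitOfNeZero Q h.ne_zero) :
      (CyclicQuaternion Q)ˣ ⧸ scalarOnePlus F (valuation Q)) * QuotientGroup.mk (unitPi Q) *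
      QuotientGroup.mk (unitOfNeZero Q h.ne_zero) = QuotientGroup.mk (unitPi Q) := by
  obtain ⟨f, hf⟩ := h.exists_algebraMap_eq
  rw [← QuotientGroup.mk_mul, ← QuotientGroup.mk_mul]
  refine mk_eq_of_smul f ?_
  ext <;> simp [hf, unitOfNeZero, unitPi, h.conj_eq, pow_succ']

/-- The homomorphism `D_{q + 1} → D^* / F^* (1 + M_D)`. -/
noncomputable def ofDihedral :
    DihedralGroup (q + 1) →* (CyclicQuaternion Q)ˣ ⧸ scalarOnePlus F (valuation Q) :=
  DihedralGroup.lift (mk_unitOfNeZero_pow h) (mk_unitPi_mul_self)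
    (mk_unitOfNeZero_mul_mk_unitPi h)

/-- Membership makes `ζ ^ k` congruent to some `f` in `F`. Applying `conj` gives `ζ ^ (q k) ≡ f ≡ ζ
^ k`, so `q ^ 2 - 1` divides `(q - 1) k`. -/
theorem dvd_of_pow_mem {k : ℕ}
    (hk : unitOfNeZero Q h.ne_zero ^ k ∈ scalarOnePlus F (valuation Q)) : q + 1 ∣ k := by
  obtain ⟨f, -, a, ha, he⟩ := (mem_scalarOnePlus _ _ _).1 hk
  rw [unitOfNeZero_pow] at he
  have he := congrArg re he
  simp only [re_mul, re_add, re_one, re_algebraMap, im_algebraMap, zero_mul, mul_zero,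
    add_zero] at he
  have h1 := val_re_lt ha
  have h2 : Q.val (1 + a.re) = 1 := Q.val.map_one_add_of_lt h1
  have h3 : Q.val (algebraMap F K f) = 1 := by
    have := congrArg Q.val he
    rwa [map_mul, h2, map_pow, h.val_eq_one, one_pow, mul_one, eq_comm] at this
  have h4 : Q.val (ζ ^ k - algebraMap F K f) < 1 := by
    rw [he, mul_add, mul_one, add_sub_cancel_left, map_mul, h3, one_mul]
    exact h1
  have h5 := h4
  rw [← Q.val_conj, map_sub, map_pow, h.conj_eq, AlgEquiv.commutes, ← pow_mul] at h5
  have h6 := Q.val.map_sub_lt h5 h4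
  have h7 : ζ ^ (q * k) - algebraMap F K f - (ζ ^ k - algebraMap F K f) =
      ζ ^ k * (ζ ^ ((q - 1) * k) - 1) := by
    have h8 : k + (q - 1) * k = q * k := by
      rw [← one_add_mul, Nat.add_sub_cancel' h.one_lt.le]
    rw [mul_sub, ← pow_add, h8]
    ring
  rw [h7, map_mul, map_pow, h.val_eq_one, one_pow, one_mul] at h6
  have h8 := h.dvd_of_val_sub_lt _ h6
  have h9 : q ^ 2 - 1 = (q - 1) * (q + 1) := by
    rw [mul_comm, ← Nat.sq_sub_sq, one_pow]
  rw [h9] at h8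
  exact Nat.dvd_of_mul_dvd_mul_left (Nat.sub_pos_of_lt h.one_lt) h8

/-- Elements of `F^*(1 + M_D)` have even value, since `F` is ramified in `D`, while `π ζ ^ k` has
the value of `π`. -/
theorem unitPi_mul_notMem (k : ℕ) :
    unitPi Q * unitOfNeZero Q h.ne_zero ^ k ∉ scalarOnePlus F (valuation Q) := by
  intro hk
  obtain ⟨f, -, a, ha, he⟩ := (mem_scalarOnePlus _ _ _).1 hk
  have he := congrArg (valuation Q) he
  rw [Units.val_mul, unitOfNeZero_pow, map_mul, map_mul, Valuation.map_one_add_of_lt _ ha,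
    mul_one, valuation_algebraMap, unitPi, Units.val_mk0, valuation_pi, valuation_apply] at he
  refine WithZero.sq_ne_exp_neg_one_mul_sq (y := 1) (Or.inr one_ne_zero) (he.symm.trans ?_)
  simp [h.val_eq_one]

theorem ofDihedral_injective : Function.Injective (ofDihedral h) := by
  rw [injective_iff_map_eq_one]
  rintro (i | i) hi <;> obtain ⟨i, rfl⟩ := ZMod.natCast_zmod_surjective i
  · rw [ofDihedral, DihedralGroup.lift_r, ← QuotientGroup.mk_pow, QuotientGroup.eq_one_iff] at hi
    rw [(ZMod.natCast_eq_zero_iff _ _).2 (dvd_of_pow_mem h hi)]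
    rfl
  · rw [ofDihedral, DihedralGroup.lift_sr, ← QuotientGroup.mk_pow, ← QuotientGroup.mk_mul,
      QuotientGroup.eq_one_iff] at hi
    exact absurd hi (unitPi_mul_notMem h i)

/-- The hypothesis says that the `K`-coordinate dominates. Scaling by a power of the uniformizer of
`F` makes it a unit, congruent to some `ζ ^ i`, while the `π`-coordinate contributes only to `M_D`.
-/
theorem exists_mk_eq_pow (d : (CyclicQuaternion Q)ˣ)
    (hd : WithZero.exp (-1) * Q.val (d : CyclicQuaternion Q).im ^ 2 <
      Q.val (d : CyclicQuaternion Q).re ^ 2) :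
    ∃ i : ℕ, (QuotientGroup.mk d : (CyclicQuaternion Q)ˣ ⧸ scalarOnePlus F (valuation Q)) =
      QuotientGroup.mk (unitOfNeZero Q h.ne_zero) ^ i := by
  have h1 : Q.val (d : CyclicQuaternion Q).re ≠ 0 := by
    intro h0
    simp [h0] at hd
  set f : F := Q.param ^ (-WithZero.log (Q.val (d : CyclicQuaternion Q).re)) with hf
  have h2 : Q.val (algebraMap F K f) = Q.val (d : CyclicQuaternion Q).re := by
    rw [hf, map_zpow₀, map_zpow₀, Q.val_param, ← WithZero.exp_zsmul]
    simp [WithZero.exp_log h1]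
  have hf0 : algebraMap F K f ≠ 0 := by
    rw [← Q.val.ne_zero_iff, h2]
    exact h1
  obtain ⟨i, hi⟩ := h.exists_val_sub_lt ((d : CyclicQuaternion Q).re / algebraMap F K f)
    (by rw [map_div₀, h2, div_self h1])
  refine ⟨i, ?_⟩
  rw [← QuotientGroup.mk_pow]
  refine (QuotientGroup.eq.2 ?_).symm
  rw [mem_scalarOnePlus]
  refine ⟨f, fun h0 => hf0 (by rw [h0, map_zero]),
    ⟨(d : CyclicQuaternion Q).re / (algebraMap F K f * ζ ^ i) - 1,
      (d : CyclicQuaternion Q).im / (algebraMap F K f * ζ ^ i)⟩, ?_, ?_⟩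
  · rw [valuation_apply]
    refine max_lt ?_ ?_
    · have h3 : (d : CyclicQuaternion Q).re / (algebraMap F K f * ζ ^ i) - 1 =
          ((d : CyclicQuaternion Q).re / algebraMap F K f - ζ ^ i) / ζ ^ i := by
        have := h.ne_zero
        field_simp
      simp only [h3, map_div₀, map_pow, h.val_eq_one, one_pow, div_one]
      exact pow_lt_one₀ zero_le hi two_ne_zero
    · simp only [map_div₀, map_mul, map_pow, h.val_eq_one, one_pow, mul_one, h2]
      rw [div_pow, ← mul_div_assoc]
      exact (div_lt_one₀ (pow_pos (zero_lt_iff.2 h1) 2)).2 hd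
  · rw [Units.val_mul, Units.inv_mul_eq_iff_eq_mul, unitOfNeZero_pow]
    have := h.ne_zero
    ext <;> simp <;> field_simp

theorem ofDihedral_surjective : Function.Surjective (ofDihedral h) := by
  intro x
  obtain ⟨d, rfl⟩ := QuotientGroup.mk_surjective x
  by_cases hd : WithZero.exp (-1) * Q.val (d : CyclicQuaternion Q).im ^ 2 <
      Q.val (d : CyclicQuaternion Q).re ^ 2
  · obtain ⟨i, hi⟩ := exists_mk_eq_pow h d hd
    exact ⟨DihedralGroup.r i, by rw [ofDihedral, DihedralGroup.lift_r, hi]⟩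
  · have h1 : Q.val (d : CyclicQuaternion Q).re ^ 2 <
        WithZero.exp (-1) * Q.val (d : CyclicQuaternion Q).im ^ 2 := by
      refine lt_of_le_of_ne (not_lt.1 hd) (WithZero.sq_ne_exp_neg_one_mul_sq ?_)
      by_contra! h0
      rw [Valuation.zero_iff, Valuation.zero_iff] at h0
      exact d.ne_zero (by ext <;> simp [h0.1, h0.2])
    -- Multiplication by `π` exchanges the coordinates up to `conj` and the uniformizer, so the
    -- `K`-coordinate becomes dominant.
    obtain ⟨i, hi⟩ := exists_mk_eq_pow h (unitPi Q * d) (by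
      have h2 : ((unitPi Q * d : (CyclicQuaternion Q)ˣ) : CyclicQuaternion Q) =
        ⟨0, 1⟩ * (d : CyclicQuaternion Q) := rfl
      simp only [h2, re_mul, im_mul, zero_mul, one_mul, zero_add, map_mul, Q.val_conj,
        Q.val_param, mul_pow]
      rw [sq (WithZero.exp (-1)), mul_assoc]
      exact mul_lt_mul_of_pos_left h1 (by simp))
    refine ⟨DihedralGroup.sr i, ?_⟩
    rw [ofDihedral, DihedralGroup.lift_sr, ← hi, QuotientGroup.mk_mul, ← mul_assoc,
      mk_unitPi_mul_self, one_mul]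

/-- `D^* / F^* (1 + M_D)` is a dihedral group. -/
noncomputable def quotientEquivDihedral :
    (CyclicQuaternion Q)ˣ ⧸ scalarOnePlus F (valuation Q) ≃* DihedralGroup (q + 1) :=
  (MulEquiv.ofBijective (ofDihedral h) ⟨ofDihedral_injective h, ofDihedral_surjective h⟩).symm

end

end CyclicQuaternion

open ValuedDivisionAlgebra in
theorem ValuedDivisionAlgebra.IsNonnormalMaximal.comap {G G' : Type*} [Group G] [Group G']
    {f : G →* G'} (hf : Function.Surjective f) {H : Subgroup G'} (hH : IsNonnormalMaximal H) :
    IsNonnormalMaximal (H.comap f) := by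
  refine ⟨?_, fun h => hH.2 ?_⟩
  · exact Subgroup.isCoatom_comap_of_surjective hf hH.1
  · rw [← Subgroup.map_comap_eq_self_of_surjective hf H]
    exact h.map f hf

/-! ### Witt vectors of a finite field and their Frobenius -/

/-- The ring of Witt vectors of the field with `ℓ ^ n` elements. -/
abbrev WittGalois (ℓ n : ℕ) [Fact ℓ.Prime] : Type := WittVector ℓ (GaloisField ℓ n)

namespace WittGalois

variable {ℓ n : ℕ} [Fact ℓ.Prime]

noncomputable instance : Algebra ℤ_[ℓ] (WittGalois ℓ n) :=
  ((WittVector.map (algebraMap (ZMod ℓ) (GaloisField ℓ n))).comp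
    (WittVector.equiv ℓ).symm.toRingHom).toAlgebra

theorem algebraMap_padicInt (z : ℤ_[ℓ]) : algebraMap ℤ_[ℓ] (WittGalois ℓ n) z =
    WittVector.map (algebraMap (ZMod ℓ) (GaloisField ℓ n)) ((WittVector.equiv ℓ).symm z) := rfl

theorem algebraMap_padicInt_injective :
    Function.Injective (algebraMap ℤ_[ℓ] (WittGalois ℓ n)) :=
  (WittVector.map_injective _ (algebraMap (ZMod ℓ) (GaloisField ℓ n)).injective).comp
    (WittVector.equiv ℓ).symm.injective

/-- The Frobenius automorphism over `ℤ_ℓ`. -/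
noncomputable def frob (ℓ n : ℕ) [Fact ℓ.Prime] : WittGalois ℓ n ≃ₐ[ℤ_[ℓ]] WittGalois ℓ n :=
  AlgEquiv.ofRingEquiv (f := WittVector.frobeniusEquiv ℓ (GaloisField ℓ n)) fun z => by
    ext i
    rw [WittVector.frobeniusEquiv_apply, WittVector.coeff_frobenius_charP, algebraMap_padicInt,
      WittVector.map_coeff, ← map_pow, ZMod.pow_card]

theorem coeff_frob (x : WittGalois ℓ n) (i : ℕ) : (frob ℓ n x).coeff i = x.coeff i ^ ℓ :=
  WittVector.coeff_frobenius_charP _ _ _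

theorem coeff_frob_pow (x : WittGalois ℓ n) (i j : ℕ) :
    ((frob ℓ n ^ j) x).coeff i = x.coeff i ^ ℓ ^ j := by
  induction j with
  | zero => simp
  | succ j ih => rw [pow_succ', AlgEquiv.mul_apply, coeff_frob, ih, ← pow_mul, pow_succ]

theorem frob_pow_teichmuller (a : GaloisField ℓ n) (j : ℕ) :
    (frob ℓ n ^ j) (WittVector.teichmuller ℓ a) = WittVector.teichmuller ℓ a ^ ℓ ^ j := by
  rw [← map_pow]
  ext i
  rw [coeff_frob_pow]
  rcases Nat.eq_zero_or_pos i with rfl | hi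
  · rw [WittVector.teichmuller_coeff_zero, WittVector.teichmuller_coeff_zero]
  · rw [WittVector.teichmuller_coeff_pos _ _ _ hi, WittVector.teichmuller_coeff_pos _ _ _ hi,
      zero_pow (pow_ne_zero _ (Fact.out : ℓ.Prime).ne_zero)]

/-- Frobenius raises each Witt coordinate to the power `ℓ`, so a fixed vector has all its
coordinates in the prime field. -/
theorem exists_algebraMap_of_frob_eq {x : WittGalois ℓ n} (h : frob ℓ n x = x) :
    ∃ z : ℤ_[ℓ], algebraMap ℤ_[ℓ] (WittGalois ℓ n) z = x := by
  have h1 : ∀ i, ∃ c : ZMod ℓ, algebraMap (ZMod ℓ) (GaloisField ℓ n) c = x.coeff i := by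
    intro i
    have h2 : x.coeff i ^ ℓ = x.coeff i := by rw [← coeff_frob, h]
    have h3 := (Subfield.mem_bot_iff_pow_eq_self (GaloisField ℓ n) ℓ).2 h2
    have h4 : (⊥ : Subfield (GaloisField ℓ n)) ≤
        (algebraMap (ZMod ℓ) (GaloisField ℓ n)).fieldRange := bot_le
    exact h4 h3
  choose c hc using h1
  refine ⟨WittVector.equiv ℓ (WittVector.mk ℓ c), ?_⟩
  ext i
  rw [algebraMap_padicInt, RingEquiv.symm_apply_apply, WittVector.map_coeff]
  exact hc i

theorem natCast_ne_zero : (ℓ : WittGalois ℓ n) ≠ 0 := WittVector.irreducible ℓ |>.ne_zero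

theorem card_galoisField [NeZero n] : Nat.card (GaloisField ℓ n) = ℓ ^ n :=
  GaloisField.card ℓ n (NeZero.ne n)

theorem exists_generator (ℓ n : ℕ) [Fact ℓ.Prime] [NeZero n] :
    ∃ a : GaloisField ℓ n, orderOf a = ℓ ^ n - 1 ∧ ∀ b ≠ 0, ∃ i : ℕ, b = a ^ i := by
  have := Fintype.ofFinite (GaloisField ℓ n)
  obtain ⟨g, hg⟩ := IsCyclic.exists_generator (α := (GaloisField ℓ n)ˣ)
  refine ⟨g, ?_, fun b hb => ?_⟩
  · rw [orderOf_units, orderOf_eq_card_of_forall_mem_zpowers hg, Nat.card_units, card_galoisField]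
  · have h := (isOfFinOrder_of_finite g).mem_powers_iff_mem_zpowers.2 (hg (Units.mk0 b hb))
    obtain ⟨i, hi⟩ := h
    exact ⟨i, by simpa using (congrArg Units.val hi).symm⟩

theorem pow_card_pow [NeZero n] (a : GaloisField ℓ n) : a ^ ℓ ^ n = a := by
  have := Fintype.ofFinite (GaloisField ℓ n)
  rw [← card_galoisField, Nat.card_eq_fintype_card, FiniteField.pow_card]

theorem orderOf_frob [NeZero n] : orderOf (frob ℓ n) = n := by
  rw [orderOf_eq_iff (Nat.pos_of_neZero n)]
  constructor
  · ext x i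
    rw [coeff_frob_pow, pow_card_pow, AlgEquiv.one_apply]
  · intro j hj hj0 h
    -- A smaller power of Frobenius is tested on the Teichmüller lift of a generator, whose order `ℓ
    -- ^ n - 1` exceeds `ℓ ^ j - 1`.
    obtain ⟨a, ha, -⟩ := exists_generator ℓ n
    have hl := (Fact.out : ℓ.Prime).one_lt
    have h1 := congrArg (fun f => (f (WittVector.teichmuller ℓ a)).coeff 0) h
    simp only [coeff_frob_pow, AlgEquiv.one_apply, WittVector.teichmuller_coeff_zero] at h1
    have h2 : 1 < ℓ ^ j := Nat.one_lt_pow hj0.ne' hl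
    have h5 : ℓ ^ j < ℓ ^ n := Nat.pow_lt_pow_right hl hj
    have ha0 : a ≠ 0 := by
      rintro rfl
      rw [orderOf_zero] at ha
      omega
    have h3 : a ^ (ℓ ^ j - 1) = 1 := by
      refine mul_right_cancel₀ ha0 ?_
      rw [← pow_succ, Nat.sub_add_cancel h2.le, h1, one_mul]
    have h4 := Nat.le_of_dvd (by omega) (orderOf_dvd_of_pow_eq_one h3)
    omega

instance [NeZero n] : Finite (Subgroup.zpowers (frob ℓ n)) := by
  refine Set.finite_coe_iff.2 (finite_zpowers.2 (orderOf_pos_iff.1 ?_))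
  rw [orderOf_frob]
  exact Nat.pos_of_neZero n

/-- Being the ring of invariants of a finite group makes `ℤ_ℓ` a base over which the Witt vectors
are integral. -/
instance isInvariant : Algebra.IsInvariant ℤ_[ℓ] (WittGalois ℓ n)
    (Subgroup.zpowers (frob ℓ n)) where
  isInvariant _ hx := exists_algebraMap_of_frob_eq (hx ⟨_, Subgroup.mem_zpowers _⟩)

instance [NeZero n] : Algebra.IsIntegral ℤ_[ℓ] (WittGalois ℓ n) :=
  Algebra.IsInvariant.isIntegral _ _ (Subgroup.zpowers (frob ℓ n))

end WittGalois

/-! ### The unramified extension of degree `n` -/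

/-- The unramified extension of `ℚ_ℓ` of degree `n`. -/
def UnramifiedPadic (ℓ n : ℕ) [Fact ℓ.Prime] : Type := FractionRing (WittGalois ℓ n)

namespace UnramifiedPadic

open WittGalois

variable {ℓ n : ℕ} [Fact ℓ.Prime]

noncomputable instance : Field (UnramifiedPadic ℓ n) :=
  inferInstanceAs (Field (FractionRing (WittGalois ℓ n)))

noncomputable instance : Algebra (WittGalois ℓ n) (UnramifiedPadic ℓ n) :=
  inferInstanceAs (Algebra (WittGalois ℓ n) (FractionRing (WittGalois ℓ n)))

instance : IsFractionRing (WittGalois ℓ n) (UnramifiedPadic ℓ n) :=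
  inferInstanceAs (IsFractionRing (WittGalois ℓ n) (FractionRing (WittGalois ℓ n)))

noncomputable instance : Algebra ℤ_[ℓ] (UnramifiedPadic ℓ n) :=
  ((algebraMap (WittGalois ℓ n) (UnramifiedPadic ℓ n)).comp
    (algebraMap ℤ_[ℓ] (WittGalois ℓ n))).toAlgebra

instance : IsScalarTower ℤ_[ℓ] (WittGalois ℓ n) (UnramifiedPadic ℓ n) :=
  .of_algebraMap_eq' rfl

theorem algebraMap_padicInt_injective :
    Function.Injective (algebraMap ℤ_[ℓ] (UnramifiedPadic ℓ n)) :=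
  (IsFractionRing.injective (WittGalois ℓ n) (UnramifiedPadic ℓ n)).comp
    WittGalois.algebraMap_padicInt_injective

noncomputable instance : Algebra ℚ_[ℓ] (UnramifiedPadic ℓ n) :=
  (IsFractionRing.lift (A := ℤ_[ℓ]) algebraMap_padicInt_injective).toAlgebra

instance : IsScalarTower ℤ_[ℓ] ℚ_[ℓ] (UnramifiedPadic ℓ n) :=
  .of_algebraMap_eq fun z => (IsFractionRing.lift_algebraMap (A := ℤ_[ℓ]) (K := ℚ_[ℓ])
    (algebraMap_padicInt_injective (n := n)) z).symm

/-- The Frobenius automorphism. -/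
noncomputable def frob (ℓ n : ℕ) [Fact ℓ.Prime] : UnramifiedPadic ℓ n ≃ₐ[ℚ_[ℓ]] UnramifiedPadic ℓ n :=
  IsFractionRing.fieldEquivOfAlgEquiv ℚ_[ℓ] (UnramifiedPadic ℓ n) (UnramifiedPadic ℓ n)
    (WittGalois.frob ℓ n)

theorem frob_algebraMap (x : WittGalois ℓ n) :
    frob ℓ n (algebraMap _ _ x) = algebraMap _ _ (WittGalois.frob ℓ n x) :=
  IsFractionRing.fieldEquivOfAlgEquiv_algebraMap ..

theorem frob_pow_algebraMap (x : WittGalois ℓ n) (j : ℕ) :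
    (frob ℓ n ^ j) (algebraMap _ _ x) = algebraMap _ _ ((WittGalois.frob ℓ n ^ j) x) := by
  induction j with
  | zero => simp
  | succ j ih => rw [pow_succ', AlgEquiv.mul_apply, ih, frob_algebraMap, pow_succ',
      AlgEquiv.mul_apply]

/-- The valuation of the unramified extension. -/
noncomputable def val (ℓ n : ℕ) [Fact ℓ.Prime] : Valuation (UnramifiedPadic ℓ n) ℤᵐ⁰ :=
  (IsDiscreteValuationRing.maximalIdeal (WittGalois ℓ n)).valuation (UnramifiedPadic ℓ n)

theorem exists_of_val_le_one {x : UnramifiedPadic ℓ n} (h : val ℓ n x ≤ 1) :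
    ∃ a : WittGalois ℓ n, algebraMap _ _ a = x :=
  IsDiscreteValuationRing.exists_lift_of_le_one h

theorem val_algebraMap_le_one (a : WittGalois ℓ n) : val ℓ n (algebraMap _ _ a) ≤ 1 :=
  IsDedekindDomain.HeightOneSpectrum.valuation_le_one _ _

theorem asIdeal_maximalIdeal : (IsDiscreteValuationRing.maximalIdeal (WittGalois ℓ n)).asIdeal =
    Ideal.span {(ℓ : WittGalois ℓ n)} :=
  (WittVector.irreducible ℓ).maximalIdeal_eq

theorem val_natCast : val ℓ n (ℓ : UnramifiedPadic ℓ n) = WithZero.exp (-1) := by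
  rw [← map_natCast (algebraMap (WittGalois ℓ n) (UnramifiedPadic ℓ n)), val,
    IsDedekindDomain.HeightOneSpectrum.valuation_of_algebraMap]
  exact IsDedekindDomain.HeightOneSpectrum.intValuation_singleton _ natCast_ne_zero
    asIdeal_maximalIdeal

/-- The zeroth Witt coordinate is the residue map, so congruences can be checked in the finite
field. -/
theorem val_algebraMap_lt_one_iff (a : WittGalois ℓ n) :
    val ℓ n (algebraMap _ _ a) < 1 ↔ a.coeff 0 = 0 := by
  rw [val, IsDedekindDomain.HeightOneSpectrum.valuation_lt_one_iff_mem]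
  change a ∈ IsLocalRing.maximalIdeal (WittGalois ℓ n) ↔ _
  rw [IsLocalRing.mem_maximalIdeal, mem_nonunits_iff, not_iff_comm]
  constructor
  · exact WittVector.isUnit_of_coeff_zero_ne_zero a
  · intro h
    exact (h.map (WittVector.constantCoeff (p := ℓ) (R := GaloisField ℓ n))).ne_zero

theorem val_frob_le_one {x : UnramifiedPadic ℓ n} (h : val ℓ n x ≤ 1) :
    val ℓ n (frob ℓ n x) ≤ 1 := by
  obtain ⟨a, rfl⟩ := exists_of_val_le_one h
  rw [frob_algebraMap]
  exact val_algebraMap_le_one _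

theorem exists_zpow_mul (x : UnramifiedPadic ℓ n) (hx : x ≠ 0) :
    ∃ (k : ℤ) (u : UnramifiedPadic ℓ n), val ℓ n u = 1 ∧ x = (ℓ : UnramifiedPadic ℓ n) ^ k * u := by
  have h0 : (val ℓ n x) ≠ 0 := (val ℓ n).ne_zero_iff.2 hx
  have hl : (ℓ : UnramifiedPadic ℓ n) ≠ 0 := by
    rw [← (val ℓ n).ne_zero_iff, val_natCast]
    simp
  have h1 : val ℓ n ((ℓ : UnramifiedPadic ℓ n) ^ (-WithZero.log (val ℓ n x))) = val ℓ n x := by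
    rw [map_zpow₀, val_natCast, ← WithZero.exp_zsmul]
    simp [WithZero.exp_log h0]
  refine ⟨-WithZero.log (val ℓ n x), x / (ℓ : UnramifiedPadic ℓ n) ^ (-WithZero.log (val ℓ n x)),
    ?_, ?_⟩
  · rw [map_div₀, h1, div_self h0]
  · rw [mul_div_cancel₀ _ (zpow_ne_zero _ hl)]

/-- Frobenius fixes `ℓ` and preserves the valuation ring; applying this to a unit and its inverse
shows that units go to units. -/
theorem val_frob (x : UnramifiedPadic ℓ n) : val ℓ n (frob ℓ n x) = val ℓ n x := by
  by_cases hx : x = 0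
  · simp [hx]
  obtain ⟨k, u, hu, rfl⟩ := exists_zpow_mul x hx
  have h1 : val ℓ n (frob ℓ n u) = 1 := by
    refine le_antisymm (val_frob_le_one hu.le) ?_
    have h2 := val_frob_le_one (x := u⁻¹) (by rw [map_inv₀, hu, inv_one])
    rw [map_inv₀, map_inv₀] at h2
    by_contra! h3
    refine h2.not_gt ((one_lt_inv₀ ?_).2 h3)
    rw [zero_lt_iff, (val ℓ n).ne_zero_iff, map_ne_zero, ← (val ℓ n).ne_zero_iff, hu]
    exact one_ne_zero
  rw [map_mul, map_zpow₀, map_natCast, map_mul, map_mul, h1, hu]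

theorem val_frob_pow (x : UnramifiedPadic ℓ n) (j : ℕ) :
    val ℓ n ((frob ℓ n ^ j) x) = val ℓ n x := by
  induction j with
  | zero => simp
  | succ j ih => rw [pow_succ', AlgEquiv.mul_apply, val_frob, ih]

theorem exists_algebraMap_of_frob_eq {x : UnramifiedPadic ℓ n} (h : frob ℓ n x = x) :
    ∃ z : ℚ_[ℓ], algebraMap ℚ_[ℓ] (UnramifiedPadic ℓ n) z = x := by
  have key : ∀ x : UnramifiedPadic ℓ n, frob ℓ n x = x → val ℓ n x ≤ 1 →
      ∃ z : ℚ_[ℓ], algebraMap ℚ_[ℓ] (UnramifiedPadic ℓ n) z = x := by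
    intro x h hx
    obtain ⟨a, rfl⟩ := exists_of_val_le_one hx
    rw [frob_algebraMap] at h
    obtain ⟨z, rfl⟩ := WittGalois.exists_algebraMap_of_frob_eq
      (IsFractionRing.injective _ (UnramifiedPadic ℓ n) h)
    refine ⟨algebraMap ℤ_[ℓ] ℚ_[ℓ] z, ?_⟩
    rw [← IsScalarTower.algebraMap_apply, ← IsScalarTower.algebraMap_apply]
  rcases le_total (val ℓ n x) 1 with hx | hx
  · exact key x h hx
  · obtain ⟨z, hz⟩ := key x⁻¹ (by rw [map_inv₀, h]) (by
      rw [map_inv₀]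
      exact inv_le_one_of_one_le₀ hx)
    exact ⟨z⁻¹, by rw [map_inv₀, hz, inv_inv]⟩

theorem orderOf_frob [NeZero n] : orderOf (frob ℓ n) = n := by
  have h1 : ∀ j, frob ℓ n ^ j = 1 ↔ WittGalois.frob ℓ n ^ j = 1 := by
    intro j
    constructor
    · intro h
      ext1 x
      apply IsFractionRing.injective (WittGalois ℓ n) (UnramifiedPadic ℓ n)
      rw [← frob_pow_algebraMap, h]
      rfl
    · intro h
      ext1 x
      obtain ⟨a, b, -, rfl⟩ := IsFractionRing.div_surjective (A := WittGalois ℓ n) x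
      rw [map_div₀, frob_pow_algebraMap, frob_pow_algebraMap, h]
      rfl
  exact (orderOf_eq_orderOf_iff.2 h1).trans WittGalois.orderOf_frob

/-- Artin's theorem then identifies the degree over `ℚ_ℓ` with the order of Frobenius. -/
instance : IsGaloisGroup (Subgroup.zpowers (frob ℓ n)) ℚ_[ℓ] (UnramifiedPadic ℓ n) where
  faithful := inferInstance
  commutes := inferInstance
  isInvariant := ⟨fun _ hx => exists_algebraMap_of_frob_eq (hx ⟨_, Subgroup.mem_zpowers _⟩)⟩

theorem finrank_eq [NeZero n] : Module.finrank ℚ_[ℓ] (UnramifiedPadic ℓ n) = n := by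
  rw [← IsGaloisGroup.card_eq_finrank (Subgroup.zpowers (frob ℓ n)), Nat.card_zpowers, orderOf_frob]

instance [NeZero n] : FiniteDimensional ℚ_[ℓ] (UnramifiedPadic ℓ n) :=
  .of_finrank_pos ((finrank_eq (ℓ := ℓ) (n := n)).symm ▸ Nat.pos_of_neZero n)

end UnramifiedPadic

namespace UnramifiedPadic

variable {ℓ n : ℕ} [Fact ℓ.Prime]

/-- Both sides are 1 on units of `ℤ_ℓ` and `exp (-1)` at `ℓ`; inversion handles elements outside
`ℤ_ℓ`. -/
theorem val_algebraMap_padic (z : ℚ_[ℓ]) :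
    val ℓ n (algebraMap ℚ_[ℓ] _ z) = Padic.mulValuation z := by
  have key : ∀ z : ℤ_[ℓ], z ≠ 0 → val ℓ n (algebraMap ℚ_[ℓ] _ (z : ℚ_[ℓ])) =
      Padic.mulValuation (z : ℚ_[ℓ]) := by
    intro z hz
    have h1 : (z : ℚ_[ℓ]) ≠ 0 := by simpa using hz
    have h2 : ∀ u : ℤ_[ℓ]ˣ, val ℓ n (algebraMap ℤ_[ℓ] _ (u : ℤ_[ℓ])) = 1 := by
      intro u
      have h3 : ∀ u : ℤ_[ℓ]ˣ, val ℓ n (algebraMap ℤ_[ℓ] _ (u : ℤ_[ℓ])) ≤ 1 := fun u => by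
        rw [IsScalarTower.algebraMap_apply ℤ_[ℓ] (WittGalois ℓ n)]
        exact val_algebraMap_le_one _
      refine le_antisymm (h3 u) ?_
      have h4 : val ℓ n (algebraMap ℤ_[ℓ] _ (u : ℤ_[ℓ])) *
          val ℓ n (algebraMap ℤ_[ℓ] _ ((u⁻¹ : ℤ_[ℓ]ˣ) : ℤ_[ℓ])) = 1 := by
        rw [← map_mul, ← map_mul, Units.mul_inv, map_one, map_one]
      rw [← h4]
      exact mul_le_of_le_one_right' (h3 _)
    have h5 : val ℓ n (algebraMap ℚ_[ℓ] _ (z : ℚ_[ℓ])) = WithZero.exp (-(z.valuation : ℤ)) := by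
      change val ℓ n (algebraMap ℚ_[ℓ] _ (algebraMap ℤ_[ℓ] ℚ_[ℓ] z)) = _
      rw [← IsScalarTower.algebraMap_apply]
      conv_lhs => rw [PadicInt.unitCoeff_spec hz]
      rw [map_mul, map_mul, h2, one_mul, map_pow, map_natCast, map_pow, val_natCast,
        ← WithZero.exp_nsmul]
      simp
    rw [h5, ← PadicInt.valuation_coe]
    exact (if_neg h1).symm
  by_cases hz : z = 0
  · simp [hz]
  rcases le_total ‖z‖ 1 with h | h
  · exact key ⟨z, h⟩ (fun h0 => hz (congrArg Subtype.val h0))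
  · have h1 : ‖z⁻¹‖ ≤ 1 := by
      rw [norm_inv]
      exact inv_le_one_of_one_le₀ h
    have h2 := key ⟨z⁻¹, h1⟩ (fun h0 => inv_ne_zero hz (congrArg Subtype.val h0))
    simp only [map_inv₀] at h2
    exact inv_injective h2

/-- The valuation ring is the ring of Witt vectors, which is integral over `ℤ_ℓ` and integrally
closed. -/
theorem isIntegral_iff [NeZero n] {x : UnramifiedPadic ℓ n} :
    IsIntegral ℤ_[ℓ] x ↔ val ℓ n x ≤ 1 := by
  constructor
  · intro h
    obtain ⟨a, rfl⟩ := IsIntegrallyClosed.isIntegral_iff.1 (h.tower_top (A := WittGalois ℓ n))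
    exact val_algebraMap_le_one a
  · intro h
    obtain ⟨a, rfl⟩ := exists_of_val_le_one h
    exact (Algebra.IsIntegral.isIntegral (R := ℤ_[ℓ]) a).algebraMap

theorem exists_eq_natCast_mul {x : UnramifiedPadic ℓ n} (h : val ℓ n x < 1) :
    ∃ y, val ℓ n y ≤ 1 ∧ x = ℓ * y := by
  obtain ⟨a, rfl⟩ := exists_of_val_le_one h.le
  have h1 := (IsDedekindDomain.HeightOneSpectrum.valuation_lt_one_iff_mem _ _).1 h
  rw [asIdeal_maximalIdeal, Ideal.mem_span_singleton] at h1
  obtain ⟨b, rfl⟩ := h1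
  exact ⟨algebraMap _ _ b, val_algebraMap_le_one b, by rw [map_mul, map_natCast]⟩

theorem val_frob_sub_pow_lt_one {x : UnramifiedPadic ℓ n} (h : val ℓ n x ≤ 1) :
    val ℓ n (frob ℓ n x - x ^ ℓ) < 1 := by
  obtain ⟨a, rfl⟩ := exists_of_val_le_one h
  rw [frob_algebraMap, ← map_pow, ← map_sub, val_algebraMap_lt_one_iff]
  change WittVector.constantCoeff (WittGalois.frob ℓ n a - a ^ ℓ) = 0
  rw [map_sub, map_pow, sub_eq_zero]
  exact WittGalois.coeff_frob a 0

/-! ### The quadratic extension `K / F` and its Teichmüller generator -/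

/-- The unramified extension of degree `m`, inside the one of degree `2 m`. -/
noncomputable def half (ℓ m : ℕ) [Fact ℓ.Prime] :
    IntermediateField ℚ_[ℓ] (UnramifiedPadic ℓ (2 * m)) :=
  IntermediateField.fixedField (Subgroup.zpowers (frob ℓ (2 * m) ^ m))

variable {m : ℕ}

theorem mem_half_iff {x : UnramifiedPadic ℓ (2 * m)} :
    x ∈ half ℓ m ↔ (frob ℓ (2 * m) ^ m) x = x := by
  rw [half, IntermediateField.mem_fixedField_iff]
  refine ⟨fun h => h _ (Subgroup.mem_zpowers _), fun h f hf => ?_⟩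
  have h1 : Subgroup.zpowers (frob ℓ (2 * m) ^ m) ≤
      MulAction.stabilizer (UnramifiedPadic ℓ (2 * m) ≃ₐ[ℚ_[ℓ]] UnramifiedPadic ℓ (2 * m)) x :=
    Subgroup.zpowers_le.2 h
  exact h1 hf

section

variable [NeZero m]

theorem orderOf_frob_pow : orderOf (frob ℓ (2 * m) ^ m) = 2 := by
  have hm := Nat.pos_of_neZero m
  rw [orderOf_pow_of_dvd (NeZero.ne m) (by rw [orderOf_frob]; exact dvd_mul_left _ _),
    orderOf_frob, Nat.mul_div_cancel _ hm]

theorem finrank_half_top : Module.finrank (half ℓ m) (UnramifiedPadic ℓ (2 * m)) = 2 := by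
  rw [half, IntermediateField.finrank_fixedField_eq_card, Nat.card_zpowers, orderOf_frob_pow]

theorem finrank_half : Module.finrank ℚ_[ℓ] (half ℓ m) = m := by
  have h := Module.finrank_mul_finrank ℚ_[ℓ] (half ℓ m) (UnramifiedPadic ℓ (2 * m))
  rw [finrank_half_top, finrank_eq] at h
  omega

/-- The unramified quadratic extension of the unramified extension of degree `m` of `ℚ_ℓ`. -/
noncomputable def quadratic (ℓ m : ℕ) [Fact ℓ.Prime] [NeZero m] :
    UnramifiedQuadratic (half ℓ m) (UnramifiedPadic ℓ (2 * m)) where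
  conj := AlgEquiv.ofRingEquiv (f := (frob ℓ (2 * m) ^ m).toRingEquiv) fun x => mem_half_iff.1 x.2
  conj_conj x := by
    change (frob ℓ (2 * m) ^ m) ((frob ℓ (2 * m) ^ m) x) = x
    have h := pow_orderOf_eq_one (frob ℓ (2 * m) ^ m)
    rw [orderOf_frob_pow, sq] at h
    rw [← AlgEquiv.mul_apply, h, AlgEquiv.one_apply]
  exists_conj_ne := by
    by_contra! h
    have h1 : frob ℓ (2 * m) ^ m = 1 := AlgEquiv.ext h
    have h2 := orderOf_frob_pow (ℓ := ℓ) (m := m)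
    rw [h1, orderOf_one] at h2
    omega
  mem_range_of_conj x hx := ⟨⟨x, mem_half_iff.2 hx⟩, rfl⟩
  val := val ℓ (2 * m)
  val_conj x := val_frob_pow x m
  param := ℓ
  val_param := by rw [map_natCast, val_natCast]

theorem exists_isTeichmullerGenerator :
    ∃ ζ, CyclicQuaternion.IsTeichmullerGenerator (quadratic ℓ m) (ℓ ^ m) ζ := by
  obtain ⟨a, ha, hg⟩ := WittGalois.exists_generator ℓ (2 * m)
  have hq : (ℓ ^ m) ^ 2 - 1 = orderOf a := by rw [ha, ← pow_mul, mul_comm]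
  refine ⟨algebraMap _ _ (WittVector.teichmuller ℓ a),
    Nat.one_lt_pow (NeZero.ne m) (Fact.out : ℓ.Prime).one_lt, ?_, ?_, ?_, ?_⟩
  · rw [hq, ← map_pow, ← map_pow, pow_orderOf_eq_one, map_one, map_one]
  · change (frob ℓ (2 * m) ^ m) _ = _
    rw [frob_pow_algebraMap, WittGalois.frob_pow_teichmuller, map_pow]
  · intro x (hx : val ℓ (2 * m) x = 1)
    obtain ⟨w, rfl⟩ := exists_of_val_le_one hx.le
    have h1 : w.coeff 0 ≠ 0 := fun h0 => ((val_algebraMap_lt_one_iff w).2 h0).ne hx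
    obtain ⟨i, hi⟩ := hg _ h1
    refine ⟨i, ?_⟩
    change val ℓ (2 * m) _ < 1
    rw [← map_pow, ← map_sub, val_algebraMap_lt_one_iff, ← map_pow]
    change WittVector.constantCoeff (w - WittVector.teichmuller ℓ (a ^ i)) = 0
    rw [map_sub, sub_eq_zero]
    change w.coeff 0 = (WittVector.teichmuller ℓ (a ^ i)).coeff 0
    rw [hi, WittVector.teichmuller_coeff_zero]
  · intro i (hi : val ℓ (2 * m) _ < 1)
    rw [← map_pow, ← map_one (algebraMap (WittGalois ℓ (2 * m)) (UnramifiedPadic ℓ (2 * m))),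
      ← map_sub, val_algebraMap_lt_one_iff, ← map_pow] at hi
    change WittVector.constantCoeff (WittVector.teichmuller ℓ (a ^ i) - 1) = 0 at hi
    rw [map_sub, map_one, sub_eq_zero] at hi
    change (WittVector.teichmuller ℓ (a ^ i)).coeff 0 = 1 at hi
    rw [WittVector.teichmuller_coeff_zero] at hi
    rw [hq]
    exact orderOf_dvd_of_pow_eq_one hi

/-- On `F` the `m`-th power of Frobenius is trivial, so `y`, the image of `x` under the power `m -
1`, has Frobenius image `x`; and Frobenius is congruent to the `ℓ`-th power modulo `ℓ`. This is
perfectness of the residue field, in the form needed for differentials. -/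
theorem exists_eq_pow_add {x : UnramifiedPadic ℓ (2 * m)} (hx : x ∈ half ℓ m)
    (hv : val ℓ (2 * m) x ≤ 1) :
    ∃ y ∈ half ℓ m, ∃ z ∈ half ℓ m, val ℓ (2 * m) y ≤ 1 ∧ val ℓ (2 * m) z ≤ 1 ∧
      x = y ^ ℓ + ℓ * z := by
  set y := (frob ℓ (2 * m) ^ (m - 1)) x with hy
  have h1 : frob ℓ (2 * m) y = x := by
    rw [hy, ← AlgEquiv.mul_apply, ← pow_succ', Nat.sub_add_cancel (Nat.pos_of_neZero m)]
    exact mem_half_iff.1 hx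
  have h2 : y ∈ half ℓ m := by
    rw [mem_half_iff, hy, ← AlgEquiv.mul_apply, ((Commute.refl _).pow_pow m (m - 1)).eq,
      AlgEquiv.mul_apply, mem_half_iff.1 hx]
  have h3 : val ℓ (2 * m) y ≤ 1 := by rwa [hy, val_frob_pow]
  have h4 := val_frob_sub_pow_lt_one h3
  rw [h1] at h4
  obtain ⟨z, hz, he⟩ := exists_eq_natCast_mul h4
  have hl : (ℓ : UnramifiedPadic ℓ (2 * m)) ≠ 0 := by
    rw [← (val ℓ (2 * m)).ne_zero_iff, val_natCast]
    simp
  refine ⟨y, h2, z, ?_, h3, hz, by rw [← he]; ring⟩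
  have h5 : z = (x - y ^ ℓ) / ℓ := by rw [he, mul_div_cancel_left₀ _ hl]
  rw [h5]
  exact div_mem (sub_mem hx (pow_mem h2 _)) (natCast_mem _ _)

end

end UnramifiedPadic

/-! ### Unramifiedness via Kähler differentials -/

namespace ValuedDivisionAlgebra

variable {ℓ : ℕ} [Fact ℓ.Prime] {F : Type*} [Field F]

open KaehlerDifferential in
/-- If the residue rings are perfect, the integral closure of `ℤ_ℓ` is unramified. -/
theorem unramified_integralClosure [Algebra ℤ_[ℓ] F] [Algebra ℚ_[ℓ] F]
    [IsScalarTower ℤ_[ℓ] ℚ_[ℓ] F] [FiniteDimensional ℚ_[ℓ] F]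
    (h : ∀ x : integralClosure ℤ_[ℓ] F, ∃ y z : integralClosure ℤ_[ℓ] F, x = y ^ ℓ + ℓ * z) :
    Algebra.Unramified ℤ_[ℓ] (integralClosure ℤ_[ℓ] F) := by
  have h1 : Module.Finite ℤ_[ℓ] (integralClosure ℤ_[ℓ] F) :=
    IsIntegralClosure.finite ℤ_[ℓ] ℚ_[ℓ] F (integralClosure ℤ_[ℓ] F)
  have hF : Algebra.FiniteType ℤ_[ℓ] (integralClosure ℤ_[ℓ] F) := inferInstance
  have hI : Algebra.IsIntegral ℤ_[ℓ] (integralClosure ℤ_[ℓ] F) := inferInstance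
  refine ⟨⟨?_⟩, hF⟩
  -- From `x = y ^ ℓ + ℓ z` every `dx` is a multiple of `ℓ`, so the finite module of differentials
  -- equals `ℓ` times itself and vanishes by Nakayama.
  have h2 : (⊤ : Submodule (integralClosure ℤ_[ℓ] F)
      (Ω[integralClosure ℤ_[ℓ] F⁄ℤ_[ℓ]])) = ⊥ := by
    refine Submodule.eq_bot_of_le_smul_of_le_jacobson_bot
      (Ideal.span {(ℓ : integralClosure ℤ_[ℓ] F)}) _ Module.Finite.fg_top ?_ ?_
    · rw [← span_range_derivation, Submodule.span_le]
      rintro _ ⟨x, rfl⟩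
      obtain ⟨y, z, rfl⟩ := h x
      rw [map_add, Derivation.leibniz_pow, Derivation.leibniz, Derivation.map_natCast, smul_zero,
        add_zero, span_range_derivation, ← Nat.cast_smul_eq_nsmul (integralClosure ℤ_[ℓ] F)]
      exact add_mem
        (Submodule.smul_mem_smul (Ideal.mem_span_singleton_self _) Submodule.mem_top)
        (Submodule.smul_mem_smul (Ideal.mem_span_singleton_self _) Submodule.mem_top)
    · rw [Ideal.span_singleton_le_iff_mem, Ideal.jacobson, Ideal.mem_sInf]
      rintro J ⟨-, hJ⟩
      -- By integrality every maximal ideal lies over `(ℓ)`, so `ℓ` is in the Jacobson radical.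
      have h3 : (J.comap (algebraMap ℤ_[ℓ] (integralClosure ℤ_[ℓ] F))).IsMaximal :=
        Ideal.isMaximal_comap_of_isIntegral_of_isMaximal J
      have h4 := IsLocalRing.eq_maximalIdeal h3
      have h5 : (ℓ : ℤ_[ℓ]) ∈ J.comap (algebraMap ℤ_[ℓ] (integralClosure ℤ_[ℓ] F)) := by
        rw [h4, PadicInt.maximalIdeal_eq_span_p]
        exact Ideal.mem_span_singleton_self _
      rwa [Ideal.mem_comap, map_natCast] at h5
  exact Submodule.subsingleton_iff _ |>.1 (subsingleton_of_bot_eq_top h2.symm)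

end ValuedDivisionAlgebra

/-! ### Finite extensions of `ℚ_ℓ` as local fields -/

namespace ValuedDivisionAlgebra

variable {ℓ : ℕ} [Fact ℓ.Prime] {F : Type*} [Field F]

/-- The absolute value of a discretely valued field, with `ℓ⁻¹` as the value of a uniformizer. -/
noncomputable def absoluteValue (ℓ : ℕ) [hl : Fact ℓ.Prime] {F : Type*} [Field F]
    (u : Valuation F ℤᵐ⁰) : AbsoluteValue F ℝ where
  toFun x := WithZeroMulInt.toNNReal (e := (ℓ : NNReal))
    (Nat.cast_ne_zero.2 hl.out.ne_zero) (u x)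
  map_mul' x y := by rw [map_mul, map_mul, NNReal.coe_mul]
  nonneg' _ := NNReal.coe_nonneg _
  eq_zero' x := by rw [NNReal.coe_eq_zero, map_eq_zero, Valuation.zero_iff]
  add_le' x y := by
    have h : StrictMono (WithZeroMulInt.toNNReal (e := (ℓ : NNReal))
        (Nat.cast_ne_zero.2 hl.out.ne_zero)) :=
      WithZeroMulInt.toNNReal_strictMono (Nat.one_lt_cast.2 hl.out.one_lt)
    rw [← NNReal.coe_add, NNReal.coe_le_coe]
    refine (h.monotone (u.map_add x y)).trans ?_
    rw [h.monotone.map_max]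
    exact max_le (le_add_of_nonneg_right zero_le) (le_add_of_nonneg_left zero_le)

theorem absoluteValue_lt_iff (u : Valuation F ℤᵐ⁰) (x y : F) :
    absoluteValue ℓ u x < absoluteValue ℓ u y ↔ u x < u y := by
  have h : StrictMono (WithZeroMulInt.toNNReal (e := (ℓ : NNReal))
      (Nat.cast_ne_zero.2 (Fact.out : ℓ.Prime).ne_zero)) :=
    WithZeroMulInt.toNNReal_strictMono (Nat.one_lt_cast.2 (Fact.out : ℓ.Prime).one_lt)
  exact NNReal.coe_lt_coe.trans h.lt_iff_lt

variable [Algebra ℚ_[ℓ] F]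

theorem absoluteValue_algebraMap {u : Valuation F ℤᵐ⁰}
    (hu : ∀ z, u (algebraMap ℚ_[ℓ] F z) = Padic.mulValuation z) (z : ℚ_[ℓ]) :
    absoluteValue ℓ u (algebraMap ℚ_[ℓ] F z) = ‖z‖ := by
  by_cases hz : z = 0
  · simp [hz]
  have h0 : Padic.mulValuation z ≠ 0 := (Valuation.ne_zero_iff _).2 hz
  rw [Padic.norm_eq_zpow_log_mulValuation hz]
  change ((WithZeroMulInt.toNNReal (e := (ℓ : NNReal)) _ (u (algebraMap ℚ_[ℓ] F z)) : NNReal) : ℝ)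
    = _
  rw [hu, WithZeroMulInt.toNNReal_neg_apply _ h0]
  simp only [NNReal.coe_zpow, NNReal.coe_natCast]
  congr 1
  generalize Padic.mulValuation z = y at h0
  obtain ⟨y, rfl⟩ := WithZero.ne_zero_iff_exists.1 h0
  rfl

/-- A finite extension of `ℚ_ℓ` with a valuation extending the `ℓ`-adic one is a local field. -/
theorem isLocalFieldFor_of_isEquiv [FiniteDimensional ℚ_[ℓ] F] {u w : Valuation F ℤᵐ⁰}
    (hu : ∀ z, u (algebraMap ℚ_[ℓ] F z) = Padic.mulValuation z) (h : w.IsEquiv u) :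
    IsLocalFieldFor w := by
  -- The norm is built from `u`, which restricts exactly to the `ℓ`-adic valuation, as a normed
  -- space over `ℚ_ℓ` requires; `w` is only equivalent to `u`.
  let : NormedField F := (absoluteValue ℓ u).toNormedField
  have hn : ∀ x : F, ‖x‖ = absoluteValue ℓ u x := fun _ => rfl
  let : NormedSpace ℚ_[ℓ] F :=
    { norm_smul_le := fun a x => by
        rw [Algebra.smul_def, norm_mul, hn, absoluteValue_algebraMap hu] }
  let : ValuativeRel F := .ofValuation w
  have hw : w.Compatible := .ofValuation w
  have hu' : u.Compatible := ⟨fun x y => h x y⟩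
  have hp : ProperSpace F := FiniteDimensional.proper ℚ_[ℓ] F
  have hl : u (algebraMap ℚ_[ℓ] F ℓ) = WithZero.exp (-1) := by
    rw [hu]
    exact (if_neg (Nat.cast_ne_zero.2 (Fact.out : ℓ.Prime).ne_zero)).trans
      (by rw [Padic.valuation_p])
  have hl1 : WithZero.exp (-1 : ℤ) < 1 := by
    rw [← WithZero.exp_zero, WithZero.exp_lt_exp]
    norm_num
  refine ⟨inferInstance, inferInstance, hw, ?_⟩
  have h1 : IsValuativeTopology F := by
    refine IsValuativeTopology.of_zero fun s => ?_
    have hlt : ∀ x y, ValuativeRel.valuation F x < ValuativeRel.valuation F y ↔ ‖x‖ < ‖y‖ := by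
      intro x y
      rw [hn, hn, absoluteValue_lt_iff, (ValuativeRel.isEquiv (ValuativeRel.valuation F) u).lt_iff_lt]
    rw [Metric.mem_nhds_iff]
    constructor
    · rintro ⟨ε, hε, hs⟩
      have h2 : ‖algebraMap ℚ_[ℓ] F ℓ‖ < 1 := by
        rw [hn, absoluteValue_algebraMap hu]
        exact Padic.norm_p_lt_one
      obtain ⟨k, hk⟩ := exists_pow_lt_of_lt_one hε h2
      have h0 : algebraMap ℚ_[ℓ] F ℓ ^ k ≠ 0 := by
        apply pow_ne_zero
        rw [← u.ne_zero_iff, hl]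
        simp
      refine ⟨Units.mk0 (ValuativeRel.valuation F (algebraMap ℚ_[ℓ] F ℓ ^ k))
        ((Valuation.ne_zero_iff _).2 h0), fun x hx => hs ?_⟩
      have h3 := (hlt _ _).1 hx
      rw [norm_pow] at h3
      exact mem_ball_zero_iff.2 (h3.trans hk)
    · rintro ⟨γ, hs⟩
      obtain ⟨c, hc⟩ := ValuativeRel.valuation_surjective (γ : ValuativeRel.ValueGroupWithZero F)
      have h0 : c ≠ 0 := by
        rintro rfl
        exact γ.ne_zero (by rw [← hc, map_zero])
      refine ⟨‖c‖, norm_pos_iff.2 h0, fun x hx => hs ?_⟩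
      change ValuativeRel.valuation F x < γ
      rw [← hc, hlt]
      exact mem_ball_zero_iff.1 hx
  have h2 : ValuativeRel.IsNontrivial F := by
    rw [ValuativeRel.isNontrivial_iff_isNontrivial u]
    exact ⟨_, by rw [hl]; simp, by rw [hl]; exact hl1.ne⟩
  exact { h1, h2, (inferInstance : LocallyCompactSpace F) with }

end ValuedDivisionAlgebra

/-! ### The field `F` and the restriction of the valuation to it -/

namespace UnramifiedPadic

open ValuedDivisionAlgebra CyclicQuaternion

variable {ℓ m : ℕ} [Fact ℓ.Prime] [NeZero m]

theorem isIntegral_half_iff [Algebra ℤ_[ℓ] (half ℓ m)] [IsScalarTower ℤ_[ℓ] ℚ_[ℓ] (half ℓ m)]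
    {x : half ℓ m} : IsIntegral ℤ_[ℓ] x ↔ val ℓ (2 * m) x ≤ 1 := by
  have h : IsScalarTower ℤ_[ℓ] (half ℓ m) (UnramifiedPadic ℓ (2 * m)) :=
    .of_algebraMap_eq fun z => by
      rw [IsScalarTower.algebraMap_apply ℤ_[ℓ] ℚ_[ℓ] (UnramifiedPadic ℓ (2 * m)),
        IsScalarTower.algebraMap_apply ℤ_[ℓ] ℚ_[ℓ] (half ℓ m),
        ← IsScalarTower.algebraMap_apply ℚ_[ℓ] (half ℓ m)]
  rw [← isIntegral_iff]
  exact (isIntegral_algebraMap_iff (algebraMap (half ℓ m) (UnramifiedPadic ℓ (2 * m))).injective).symm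

theorem isFiniteUnramifiedPadic_half : IsFiniteUnramifiedPadic ℓ (half ℓ m) := by
  refine ⟨inferInstance, ?_⟩
  let : Algebra ℤ_[ℓ] (half ℓ m) :=
    ((algebraMap ℚ_[ℓ] (half ℓ m)).comp (algebraMap ℤ_[ℓ] ℚ_[ℓ])).toAlgebra
  have : IsScalarTower ℤ_[ℓ] ℚ_[ℓ] (half ℓ m) := .of_algebraMap_eq' rfl
  refine unramified_integralClosure fun x => ?_
  obtain ⟨y, hy, z, hz, hy1, hz1, he⟩ := exists_eq_pow_add x.1.2 (isIntegral_half_iff.1 x.2)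
  exact ⟨⟨⟨y, hy⟩, isIntegral_half_iff.2 hy1⟩, ⟨⟨z, hz⟩, isIntegral_half_iff.2 hz1⟩,
    Subtype.ext (Subtype.ext he)⟩

/-- On `F` the norm is squaring, so the valuation of `D` restricts to the square of that of `K`:
equivalent, not equal. -/
theorem comap_valuation_isEquiv {F : Type*} [Field F] (φ : F →+* half ℓ m) :
    (((valuation (quadratic ℓ m)).comap (algebraMap (half ℓ m) _)).comap φ).IsEquiv
      (((val ℓ (2 * m)).comap (algebraMap (half ℓ m) _)).comap φ) := by
  intro x y
  change valuation (quadratic ℓ m) (algebraMap _ _ (φ x)) ≤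
    valuation (quadratic ℓ m) (algebraMap _ _ (φ y)) ↔ _
  rw [valuation_algebraMap, valuation_algebraMap]
  exact pow_le_pow_iff_left₀ zero_le zero_le two_ne_zero

theorem isEquiv_mulValuation :
    (((valuation (quadratic ℓ m)).comap (algebraMap (half ℓ m) _)).comap
      (algebraMap ℚ_[ℓ] (half ℓ m))).IsEquiv (Padic.mulValuation (p := ℓ)) := by
  have h : ((val ℓ (2 * m)).comap (algebraMap (half ℓ m) _)).comap
      (algebraMap ℚ_[ℓ] (half ℓ m)) = Padic.mulValuation (p := ℓ) :=
    Valuation.ext fun z => val_algebraMap_padic z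
  rw [← h]
  exact comap_valuation_isEquiv _

theorem isLocalFieldFor_half :
    IsLocalFieldFor ((valuation (quadratic ℓ m)).comap (algebraMap (half ℓ m) _)) :=
  isLocalFieldFor_of_isEquiv (ℓ := ℓ)
    (u := (val ℓ (2 * m)).comap (algebraMap (half ℓ m) (UnramifiedPadic ℓ (2 * m))))
    (fun z => val_algebraMap_padic z) (comap_valuation_isEquiv (RingHom.id _))

end UnramifiedPadic

open ValuedDivisionAlgebra in
theorem ValuedDivisionAlgebra.exists_isNonnormalMaximal_of_quotient {G : Type*} [Group G]
    {N : Subgroup G} [N.Normal] {n p : ℕ} (e : G ⧸ N ≃* DihedralGroup n) (hp : p.Prime)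
    (ho : Odd p) (hn : p ∣ n) :
    ∃ H : Subgroup G, N ≤ H ∧ IsNonnormalMaximal H ∧ H.index = p := by
  obtain ⟨H, hH, hi⟩ := DihedralGroup.exists_isNonnormalMaximal hp ho hn
  have hs : Function.Surjective (e.toMonoidHom.comp (QuotientGroup.mk' N)) :=
    e.surjective.comp (QuotientGroup.mk'_surjective N)
  refine ⟨H.comap (e.toMonoidHom.comp (QuotientGroup.mk' N)), fun g hg => ?_, hH.comap hs, ?_⟩
  · have h1 : (e.toMonoidHom.comp (QuotientGroup.mk' N)) g = 1 := by
      change e (QuotientGroup.mk g) = 1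
      rw [(QuotientGroup.eq_one_iff g).2 hg, map_one]
    rw [Subgroup.mem_comap, h1]
    exact one_mem H
  · rw [Subgroup.index_comap_of_surjective _ hs, hi]

theorem mainTheorem9 :
    (∀ (ℓ m q : ℕ) [Fact ℓ.Prime], 0 < m → q = ℓ ^ m →
      ∃ (F : Type) (_ : Field F) (_ : Algebra ℚ_[ℓ] F)
        (D : Type) (_ : DivisionRing D) (_ : Algebra F D) (v : Valuation D ℤᵐ⁰),
        ValuedDivisionAlgebra.IsFiniteUnramifiedPadic ℓ F ∧
        Module.finrank ℚ_[ℓ] F = m ∧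
        ValuedDivisionAlgebra.IsQuaternionDivisionAlgebra F D ∧
        Function.Surjective v ∧
        ((v.comap (algebraMap F D)).comap (algebraMap ℚ_[ℓ] F)).IsEquiv
          (Padic.mulValuation (p := ℓ)) ∧
        ValuedDivisionAlgebra.IsLocalFieldFor (v.comap (algebraMap F D)) ∧
        Nonempty (Dˣ ⧸ ValuedDivisionAlgebra.scalarOnePlus F v ≃* DihedralGroup (q + 1)) ∧
        ∀ p : ℕ, p.Prime → Odd p → p ∣ q + 1 →
          ∃ H : Subgroup Dˣ, ValuedDivisionAlgebra.scalarOnePlus F v ≤ H ∧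
            ValuedDivisionAlgebra.IsNonnormalMaximal H ∧ H.index = p) ∧
    (∀ n : ℕ, 2 < n →
      (∀ p : ℕ, p.Prime → Odd p → p ∣ n →
        ∃ H : Subgroup (DihedralGroup n),
          ValuedDivisionAlgebra.IsNonnormalMaximal H ∧ H.index = p) ∧
      (∀ H : Subgroup (DihedralGroup n), ValuedDivisionAlgebra.IsNonnormalMaximal H →
        H.index.Prime ∧ Odd H.index ∧ H.index ∣ n)) := by

  refine ⟨fun ℓ m q hl hm hq => ?_, fun n hn => ?_⟩
  · subst hq
    have : NeZero m := ⟨hm.ne'⟩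
    obtain ⟨ζ, hζ⟩ := UnramifiedPadic.exists_isTeichmullerGenerator (ℓ := ℓ) (m := m)
    exact ⟨UnramifiedPadic.half ℓ m, inferInstance, inferInstance,
      CyclicQuaternion (UnramifiedPadic.quadratic ℓ m), inferInstance, inferInstance,
      CyclicQuaternion.valuation _, UnramifiedPadic.isFiniteUnramifiedPadic_half,
      UnramifiedPadic.finrank_half,
      CyclicQuaternion.isQuaternionDivisionAlgebra _ UnramifiedPadic.finrank_half_top,
      CyclicQuaternion.valuation_surjective _, UnramifiedPadic.isEquiv_mulValuation,
      UnramifiedPadic.isLocalFieldFor_half, ⟨CyclicQuaternion.quotientEquivDihedral hζ⟩,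
      fun p hp ho hd => ValuedDivisionAlgebra.exists_isNonnormalMaximal_of_quotient
        (CyclicQuaternion.quotientEquivDihedral hζ) hp ho hd⟩
  · have : NeZero n := ⟨by omega⟩
    exact ⟨fun p hp ho hd => DihedralGroup.exists_isNonnormalMaximal hp ho hd,
      fun H hH => DihedralGroup.index_of_isNonnormalMaximal hH⟩
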